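/- **Nullspace, nondegeneracy, and resonance.** All functions on $\mathbb{R}$ are real-valued and identified when equal almost everywhere. For $k \in \mathbb{N}$ let $$f_k(x) = \mathrm{Re}\Big(\mathrm{i}\,\frac{x-\mathrm{i}}{x+\mathrm{i}}\Big)^k, \qquad g_k(x) = \mathrm{Im}\Big(\mathrm{i}\,\frac{x-\mathrm{i}}{x+\mathrm{i}}\Big)^k ,$$ and for $m \geq 1$ let $\mathbf{Q}_m = (f_m, g_m, 0) : \mathbb{R} \to \mathbb{S}^2$ be the pure-power half-harmonic map of degree $m$. Let $\dot{H}^{1/2}(\mathbb{R})$ be the space of all $\varphi$ with $$\int_{\mathbb{R}} \frac{|\varphi(x)|}{1+x^2}\,dx < \infty \quad\text{and}\quad \frac{1}{2\pi} \iint_{\mathbb{R}\times\mathbb{R}} \frac{|\varphi(x)-\varphi(y)|^2}{|x-y|^2}\,dx\,dy < \infty .$$ Let $|\nabla| = \sqrt{-\Delta}$, that is, $(|\nabla|\psi)(x) = \frac{1}{\pi}\,\mathrm{p.v.}\!\int_{\mathbb{R}} \frac{\psi(x)-\psi(y)}{|x-y|^2}\,dy$ for $\psi \in C_c^\infty(\mathbb{R})$,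 extended by duality to $\varphi \in \dot{H}^{1/2}(\mathbb{R})$ through $\langle |\nabla|\varphi, \psi\rangle = \int_{\mathbb{R}} \varphi\, |\nabla|\psi\,dx$. Set $$L_+ = |\nabla| - |\partial_x \mathbf{Q}_m|, \qquad L_- = L_+ + R, \qquad (R\varphi)(x) = \frac{1}{2\pi}\int_{\mathbb{R}} \frac{|\mathbf{Q}_m(x)-\mathbf{Q}_m(y)|^2}{|x-y|^2}\,\varphi(y)\,dy ,$$ and $\mathcal{N}(L_\pm) = \{\varphi \in \dot{H}^{1/2}(\mathbb{R}) : L_\pm \varphi = 0 \text{ in } \mathcal{D}'(\mathbb{R})\}$. Then for every $m \geq 1$: $$\mathcal{N}(L_+) = \mathrm{span}\{f_m, g_m\}, \qquad \mathcal{N}(L_-) = \mathrm{span}\{1, f_1, \ldots, f_m, g_1, \ldots, g_m\}.$$ Consequently $\dim \mathcal{N}(L_+) = 2$ and $\dim \mathcal{N}(L_-) = 2m+1$, which is the nondegeneracy of the linearized operator $L = \mathrm{diag}(L_+, L_-)$ around $\mathbf{Q}_m$. Moreover, $L_+$ and $L_-$ have a common resonance $\varphi \in \dot{H}^{1/2}(\mathbb{R})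 \setminus L^2(\mathbb{R})$ with $L_+\varphi = L_-\varphi = 0$, given by $$\varphi = g_m \ \text{ if } m \text{ is odd}, \qquad \varphi = f_m \ \text{ if } m \text{ is even}.$$ -/

import Mathlib

open MeasureTheory

noncomputable section

namespace HalfHarmonic

/-- `z(x) = i (x - i) / (x + i)`, the inverse stereographic projection `ℝ → 𝕊¹`. -/
def z (x : ℝ) : ℂ := Complex.I * (((x : ℂ) - Complex.I) / ((x : ℂ) + Complex.I))

/-- `f_k = Re z^k`. -/
def f (k : ℕ) (x : ℝ) : ℝ := (z x ^ k).re

/-- `g_k = Im z^k`. -/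
def g (k : ℕ) (x : ℝ) : ℝ := (z x ^ k).im

/-- The pure-power half-harmonic map `Q_m = (f_m, g_m, 0)` of degree `m`. -/
def Q (m : ℕ) (x : ℝ) : EuclideanSpace ℝ (Fin 3) := !₂[f m x, g m x, 0]

/-- `|∇| ψ` for a test function `ψ`, where `|∇| = √(-Δ)` on `ℝ`: the singular integral
`(1/π) p.v. ∫ (ψ(x) - ψ(y)) / |x - y|² dy`. The principal value is taken by pairing
`y = x + h` with `y = x - h`, which makes the integral absolutely convergent. -/
def absNabla (ψ : ℝ → ℝ) (x : ℝ) : ℝ :=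
  Real.pi⁻¹ * ∫ h in Set.Ioi (0 : ℝ), (2 * ψ x - ψ (x + h) - ψ (x - h)) / h ^ 2

/-- The kernel `|Q_m(x) - Q_m(y)|² / |x - y|²`. -/
def kernel (m : ℕ) (x y : ℝ) : ℝ := ‖Q m x - Q m y‖ ^ 2 / |x - y| ^ 2

/-- `(R φ)(x) = (1/2π) ∫ |Q_m(x) - Q_m(y)|² / |x - y|² φ(y) dy`. -/
def R (m : ℕ) (φ : ℝ → ℝ) (x : ℝ) : ℝ := (2 * Real.pi)⁻¹ * ∫ y, kernel m x y * φ y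

/-- The distribution `L₊ φ = |∇| φ - |∂ₓ Q_m| φ` evaluated at the test function `ψ`;
`|∇| φ` is defined by duality. -/
def Lplus (m : ℕ) (φ ψ : ℝ → ℝ) : ℝ :=
  (∫ x, φ x * absNabla ψ x) - ∫ x, ‖deriv (Q m) x‖ * φ x * ψ x

/-- The distribution `L₋ φ = L₊ φ + R φ` evaluated at the test function `ψ`. -/
def Lminus (m : ℕ) (φ ψ : ℝ → ℝ) : ℝ :=
  Lplus m φ ψ + ∫ x, R m φ x * ψ x

/-- Membership in `L_{1/2}(ℝ)`: `∫ |φ(x)| / (1 + x²) dx < ∞`. -/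
def MemLHalf (φ : ℝ → ℝ) : Prop := Integrable fun x : ℝ => φ x / (1 + x ^ 2)

/-- The squared seminorm `(1/2π) ∬ |φ(x) - φ(y)|² / |x - y|² dx dy` of `Ḣ^{1/2}(ℝ)`. -/
def seminormSq (φ : ℝ → ℝ) : ENNReal :=
  ENNReal.ofReal (2 * Real.pi)⁻¹ *
    ∫⁻ p : ℝ × ℝ, ENNReal.ofReal (|φ p.1 - φ p.2| ^ 2 / |p.1 - p.2| ^ 2)

/-! ### Facts that make the spaces below linear -/

lemma continuous_z : Continuous z := by
  unfold z
  refine continuous_const.mul (Continuous.div (by fun_prop) (by fun_prop) ?_)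
  intro x h
  have := congrArg Complex.im h
  simp at this

lemma continuous_f (k : ℕ) : Continuous (f k) :=
  Complex.continuous_re.comp (continuous_z.pow k)

lemma continuous_g (k : ℕ) : Continuous (g k) :=
  Complex.continuous_im.comp (continuous_z.pow k)

lemma contDiff_z : ContDiff ℝ 1 z := by
  have hx : ContDiff ℝ 1 (fun x : ℝ => (x : ℂ)) := Complex.ofRealCLM.contDiff
  unfold z
  simp only [div_eq_mul_inv]
  refine contDiff_const.mul ((hx.sub contDiff_const).mul ((hx.add contDiff_const).inv ?_))
  intro x h
  have := congrArg Complex.im h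
  simp at this

lemma contDiff_Q (m : ℕ) : ContDiff ℝ 1 (Q m) := by
  have hf : ContDiff ℝ 1 (f m) := Complex.reCLM.contDiff.comp (contDiff_z.pow m)
  have hg : ContDiff ℝ 1 (g m) := Complex.imCLM.contDiff.comp (contDiff_z.pow m)
  rw [contDiff_euclidean]
  intro i
  fin_cases i
  · simpa [Q] using hf
  · simpa [Q] using hg
  · simpa [Q] using (contDiff_const : ContDiff ℝ 1 fun _ : ℝ => (0 : ℝ))

lemma normSq_add_I (x : ℝ) : ‖(x : ℂ) + Complex.I‖ ^ 2 = 1 + x ^ 2 := by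
  rw [← Complex.normSq_eq_norm_sq]; simp [Complex.normSq_apply]; ring

lemma norm_z (x : ℝ) : ‖z x‖ = 1 := by
  have h1 : ‖(x : ℂ) - Complex.I‖ = ‖(x : ℂ) + Complex.I‖ := by
    rw [← Complex.norm_conj]; simp
  have h2 : ‖(x : ℂ) + Complex.I‖ ≠ 0 := by
    intro h
    have := normSq_add_I x
    rw [h] at this
    nlinarith [sq_nonneg x]
  simp [z, h1, h2]

lemma norm_z_sub (x y : ℝ) :
    ‖z x - z y‖ ^ 2 = 4 * |x - y| ^ 2 / ((1 + x ^ 2) * (1 + y ^ 2)) := by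
  have ne (t : ℝ) : (t : ℂ) + Complex.I ≠ 0 := by
    intro h
    have := congrArg Complex.im h
    simp at this
  have h : z x - z y =
      -2 * ((x - y : ℝ) : ℂ) / (((x : ℂ) + Complex.I) * ((y : ℂ) + Complex.I)) := by
    have hx := ne x
    have hy := ne y
    unfold z
    field_simp
    push_cast
    linear_combination 2 * ((x : ℂ) - y) * Complex.I_sq
  rw [h, norm_div, norm_mul, norm_mul, div_pow, mul_pow, mul_pow, normSq_add_I, normSq_add_I,
    Complex.norm_real, Real.norm_eq_abs]
  norm_num

lemma norm_pow_sub_le {a b : ℂ} (ha : ‖a‖ = 1) (hb : ‖b‖ = 1) (m : ℕ) :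
    ‖a ^ m - b ^ m‖ ≤ m * ‖a - b‖ := by
  induction m with
  | zero => simp
  | succ k ih =>
    have : a ^ (k + 1) - b ^ (k + 1) = a ^ k * (a - b) + (a ^ k - b ^ k) * b := by ring
    rw [this]
    refine (norm_add_le _ _).trans ?_
    rw [norm_mul, norm_mul, norm_pow, ha, hb, one_pow]
    push_cast
    linarith

lemma norm_Q_sub (m : ℕ) (x y : ℝ) : ‖Q m x - Q m y‖ = ‖z x ^ m - z y ^ m‖ := by
  rw [EuclideanSpace.norm_eq, Complex.norm_eq_sqrt_sq_add_sq]
  congr 1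
  simp [Fin.sum_univ_three, Q, f, g]

lemma kernel_nonneg (m : ℕ) (x y : ℝ) : 0 ≤ kernel m x y := by
  unfold kernel; positivity

lemma kernel_le (m : ℕ) (x y : ℝ) : kernel m x y * (1 + y ^ 2) ≤ 4 * (m : ℝ) ^ 2 := by
  unfold kernel
  rw [norm_Q_sub]
  rcases eq_or_ne x y with rfl | hxy
  · simp
  have h0 : 0 < |x - y| ^ 2 := pow_pos (abs_pos.mpr (sub_ne_zero.mpr hxy)) 2
  have h1 : ‖z x ^ m - z y ^ m‖ ^ 2 ≤ (m * ‖z x - z y‖) ^ 2 :=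
    pow_le_pow_left₀ (norm_nonneg _) (norm_pow_sub_le (norm_z x) (norm_z y) m) 2
  rw [mul_pow, norm_z_sub] at h1
  have hy : 0 < 1 + y ^ 2 := by positivity
  have hx : 0 < 1 + x ^ 2 := by positivity
  have h2 : ‖z x ^ m - z y ^ m‖ ^ 2 / |x - y| ^ 2 * (1 + y ^ 2) ≤
      (m : ℝ) ^ 2 * (4 * |x - y| ^ 2 / ((1 + x ^ 2) * (1 + y ^ 2))) / |x - y| ^ 2 *
        (1 + y ^ 2) := by gcongr
  refine h2.trans ?_
  have h3 : (m : ℝ) ^ 2 * (4 * |x - y| ^ 2 / ((1 + x ^ 2) * (1 + y ^ 2))) / |x - y| ^ 2 *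
        (1 + y ^ 2) = 4 * (m : ℝ) ^ 2 / (1 + x ^ 2) := by
    field_simp
  rw [h3]
  exact div_le_self (by positivity) (by nlinarith [sq_nonneg x])

lemma measurable_kernel (m : ℕ) : Measurable (Function.uncurry (kernel m)) := by
  have hQ := (contDiff_Q m).continuous
  unfold kernel Function.uncurry
  have h1 : Continuous fun p : ℝ × ℝ => ‖Q m p.1 - Q m p.2‖ ^ 2 := by fun_prop
  have h2 : Continuous fun p : ℝ × ℝ => |p.1 - p.2| ^ 2 := by fun_prop
  exact h1.measurable.div h2.measurable

lemma MemLHalf.mul {φ w : ℝ → ℝ} (hφ : MemLHalf φ) (hw : AEStronglyMeasurable w)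
    {C : ℝ} (hC : ∀ x, |w x| * (1 + x ^ 2) ≤ C) : Integrable fun x => φ x * w x := by
  have h := Integrable.mul_bdd (c := C) (g := fun x : ℝ => w x * (1 + x ^ 2)) hφ
    (hw.mul (by fun_prop : Continuous fun x : ℝ => 1 + x ^ 2).aestronglyMeasurable)
    (Filter.Eventually.of_forall fun x => by
      rw [Real.norm_eq_abs, abs_mul, abs_of_pos (by positivity : 0 < 1 + x ^ 2)]
      exact hC x)
  refine h.congr (Filter.Eventually.of_forall fun x => ?_)
  have : (1 + x ^ 2 : ℝ) ≠ 0 := by positivity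
  simp only
  field_simp

lemma integrable_kernel {m : ℕ} {φ : ℝ → ℝ} (hφ : MemLHalf φ) (x : ℝ) :
    Integrable fun y => kernel m x y * φ y := by
  have := hφ.mul (w := kernel m x) (C := 4 * (m : ℝ) ^ 2)
    ((measurable_kernel m).comp measurable_prodMk_left).aestronglyMeasurable
    (fun y => by rw [abs_of_nonneg (kernel_nonneg m x y)]; exact kernel_le m x y)
  simpa [mul_comm] using this

lemma R_bound {m : ℕ} {φ : ℝ → ℝ} (hφ : MemLHalf φ) : ∃ C, ∀ x, |R m φ x| ≤ C := by
  refine ⟨(2 * Real.pi)⁻¹ * ∫ y, 4 * (m : ℝ) ^ 2 * ‖φ y / (1 + y ^ 2)‖, fun x => ?_⟩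
  unfold R
  rw [abs_mul, abs_of_pos (by positivity : 0 < (2 * Real.pi)⁻¹)]
  gcongr
  rw [← Real.norm_eq_abs]
  refine norm_integral_le_of_norm_le (hφ.norm.const_mul _) (Filter.Eventually.of_forall ?_)
  intro y
  have hy : 0 < 1 + y ^ 2 := by positivity
  rw [norm_mul, norm_div, Real.norm_eq_abs (kernel m x y), abs_of_nonneg (kernel_nonneg m x y),
    Real.norm_eq_abs (1 + y ^ 2), abs_of_pos hy, mul_div_assoc', le_div_iff₀ hy]
  nlinarith [mul_le_mul_of_nonneg_right (kernel_le m x y) (norm_nonneg (φ y))]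

lemma integrable_R_mul {m : ℕ} {φ : ℝ → ℝ} (hφ : MemLHalf φ) (hm : StronglyMeasurable φ)
    {ψ : ℝ → ℝ} (hψ : Continuous ψ) (hc : HasCompactSupport ψ) :
    Integrable fun x => R m φ x * ψ x := by
  obtain ⟨C, hC⟩ := R_bound (m := m) hφ
  have hR : StronglyMeasurable (R m φ) := by
    unfold R
    refine StronglyMeasurable.const_mul ?_ _
    refine StronglyMeasurable.integral_prod_right
      (f := fun x y => kernel m x y * φ y) ?_
    exact ((measurable_kernel m).mul (hm.measurable.comp measurable_snd)).stronglyMeasurable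
  exact (hψ.integrable_of_hasCompactSupport hc).bdd_mul hR.aestronglyMeasurable
    (Filter.Eventually.of_forall hC)

lemma integrable_potential {m : ℕ} {φ : ℝ → ℝ} (hφ : MemLHalf φ)
    {ψ : ℝ → ℝ} (hψ : Continuous ψ) (hc : HasCompactSupport ψ) :
    Integrable fun x => ‖deriv (Q m) x‖ * φ x * ψ x := by
  have hd : Continuous (deriv (Q m)) := (contDiff_Q m).continuous_deriv le_rfl
  have hw : Continuous fun x => ‖deriv (Q m) x‖ * ψ x := hd.norm.mul hψ
  have hw2 : Continuous fun x : ℝ => (‖deriv (Q m) x‖ * ψ x) * (1 + x ^ 2) := by fun_prop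
  have hcs : HasCompactSupport fun x : ℝ => (‖deriv (Q m) x‖ * ψ x) * (1 + x ^ 2) :=
    (hc.mul_left (f := fun x => ‖deriv (Q m) x‖)).mul_right
  obtain ⟨C, hC⟩ := hcs.exists_bound_of_continuous hw2
  have := hφ.mul (w := fun x => ‖deriv (Q m) x‖ * ψ x) (C := C) hw.aestronglyMeasurable
    (fun x => by
      have := hC x
      rwa [Real.norm_eq_abs, abs_mul, abs_of_pos (by positivity : 0 < 1 + x ^ 2)] at this)
  refine this.congr (Filter.Eventually.of_forall fun x => ?_)
  simp only
  ring

lemma second_difference_le {ψ : ℝ → ℝ} (hψ : ContDiff ℝ (⊤ : ℕ∞) ψ) (hc : HasCompactSupport ψ) :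
    ∃ B, 0 ≤ B ∧ ∀ x h, 0 ≤ h → |2 * ψ x - ψ (x + h) - ψ (x - h)| ≤ B * h ^ 2 := by
  have hd1 : ContDiff ℝ 1 (deriv ψ) :=
    ((contDiff_infty_iff_deriv.mp hψ).2).of_le (by exact_mod_cast le_top)
  obtain ⟨K, hK⟩ := hd1.lipschitzWith_of_hasCompactSupport hc.deriv one_ne_zero
  have hdiff : Differentiable ℝ ψ := hψ.differentiable (by simp)
  refine ⟨2 * K, by positivity, fun x h hh => ?_⟩
  have hF (t : ℝ) : HasDerivAt (fun s => 2 * ψ x - ψ (x + s) - ψ (x - s))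
      (-deriv ψ (x + t) + deriv ψ (x - t)) t := by
    have h1 : HasDerivAt (fun s => ψ (x + s)) (deriv ψ (x + t)) t :=
      (hdiff (x + t)).hasDerivAt.comp_const_add x t
    have h2 : HasDerivAt (fun s => ψ (x - s)) (-deriv ψ (x - t)) t :=
      (hdiff (x - t)).hasDerivAt.comp_const_sub x t
    have := (h1.const_sub (2 * ψ x)).sub h2
    rw [sub_neg_eq_add] at this
    exact this
  have key := (convex_Icc (0 : ℝ) h).norm_image_sub_le_of_norm_hasDerivWithin_le
    (C := 2 * K * h) (fun t _ => (hF t).hasDerivWithinAt) (fun t ht => by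
      have := hK.dist_le_mul (x - t) (x + t)
      rw [Real.dist_eq, Real.dist_eq] at this
      have e : |x - t - (x + t)| = 2 * t := by
        rw [show x - t - (x + t) = -(2 * t) by ring, abs_neg, abs_of_nonneg (by linarith [ht.1])]
      rw [e] at this
      rw [Real.norm_eq_abs, show -deriv ψ (x + t) + deriv ψ (x - t) =
        deriv ψ (x - t) - deriv ψ (x + t) by ring]
      refine this.trans ?_
      nlinarith [mul_le_mul_of_nonneg_left ht.2 K.coe_nonneg])
    (Set.left_mem_Icc.mpr hh) (Set.right_mem_Icc.mpr hh)
  simp only [add_zero, sub_zero, Real.norm_eq_abs, abs_of_nonneg hh] at key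
  rw [show 2 * ψ x - ψ (x + h) - ψ (x - h) =
    2 * ψ x - ψ (x + h) - ψ (x - h) - (2 * ψ x - ψ x - ψ x) by ring]
  refine key.trans (le_of_eq ?_)
  ring

lemma absNabla_bound {ψ : ℝ → ℝ} (hψ : ContDiff ℝ (⊤ : ℕ∞) ψ) (hc : HasCompactSupport ψ) :
    ∃ C, ∀ x, |absNabla ψ x| * (1 + x ^ 2) ≤ C := by
  obtain ⟨B, hB0, hB⟩ := second_difference_le hψ hc
  obtain ⟨A, hA⟩ := hc.exists_bound_of_continuous hψ.continuous
  simp only [Real.norm_eq_abs] at hA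
  have hA0 : 0 ≤ A := (abs_nonneg _).trans (hA 0)
  obtain ⟨M, hM1, hM⟩ : ∃ M : ℝ, 1 ≤ M ∧ ∀ x, M < |x| → ψ x = 0 := by
    obtain ⟨r, hr⟩ := hc.isCompact.isBounded.subset_closedBall (0 : ℝ)
    refine ⟨max 1 r, le_max_left _ _, fun x hx => ?_⟩
    by_contra hne
    have := hr (subset_tsupport ψ hne)
    rw [mem_closedBall_zero_iff, Real.norm_eq_abs] at this
    linarith [le_max_right 1 r]
  have hpi : (0 : ℝ) < Real.pi⁻¹ := by positivity
  set I₀ : ℝ := ∫ h in Set.Ioi (0 : ℝ), (4 * A + B) * (1 + h ^ 2)⁻¹ with hI₀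
  have hI₀0 : 0 ≤ I₀ := integral_nonneg fun h => by positivity
  have hfirst (x : ℝ) : |absNabla ψ x| ≤ Real.pi⁻¹ * I₀ := by
    unfold absNabla
    rw [abs_mul, abs_of_pos hpi]
    gcongr
    rw [← Real.norm_eq_abs]
    refine norm_integral_le_of_norm_le
      ((integrable_inv_one_add_sq.const_mul _).integrableOn) ?_
    refine (ae_restrict_iff' measurableSet_Ioi).mpr (Filter.Eventually.of_forall fun h hh => ?_)
    have hh' : (0 : ℝ) < h := hh
    have h1 := hB x h hh'.le
    have h2 : |2 * ψ x - ψ (x + h) - ψ (x - h)| ≤ 4 * A := by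
      have a1 := abs_le.mp (hA x)
      have a2 := abs_le.mp (hA (x + h))
      have a3 := abs_le.mp (hA (x - h))
      rw [abs_le]
      constructor <;> linarith [a1.1, a1.2, a2.1, a2.2, a3.1, a3.2]
    rw [Real.norm_eq_abs, abs_div, abs_of_pos (by positivity : 0 < h ^ 2), ← div_eq_mul_inv,
      div_le_div_iff₀ (by positivity) (by positivity)]
    nlinarith [mul_le_mul_of_nonneg_right h2 (sq_nonneg h)]
  have hsecond (x : ℝ) (hx : 2 * M < |x|) :
      |absNabla ψ x| ≤ Real.pi⁻¹ * (2 * M * (8 * A / x ^ 2)) := by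
    have hx0 : 0 < |x| := by linarith
    have hx2 : 0 < x ^ 2 := by rw [← sq_abs]; positivity
    unfold absNabla
    rw [abs_mul, abs_of_pos hpi]
    gcongr
    rw [← Real.norm_eq_abs]
    have hint : IntegrableOn (fun _ : ℝ => 8 * A / x ^ 2) (Set.Icc (|x| - M) (|x| + M)) :=
      integrableOn_const (by simp)
    have hle := norm_integral_le_of_norm_le
      (f := fun h => (2 * ψ x - ψ (x + h) - ψ (x - h)) / h ^ 2)
      (μ := volume.restrict (Set.Ioi (0 : ℝ)))
      (g := (Set.Icc (|x| - M) (|x| + M)).indicator fun _ => 8 * A / x ^ 2)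
      ((integrable_indicator_iff measurableSet_Icc).mpr hint).integrableOn
      ((ae_restrict_iff' measurableSet_Ioi).mpr (Filter.Eventually.of_forall fun h hh => by
        have hh' : (0 : ℝ) < h := hh
        have hψx : ψ x = 0 := hM x (by linarith)
        by_cases hmem : h ∈ Set.Icc (|x| - M) (|x| + M)
        · rw [Set.indicator_of_mem hmem, Real.norm_eq_abs, abs_div,
            abs_of_pos (by positivity : 0 < h ^ 2), div_le_div_iff₀ (by positivity) hx2, hψx]
          have a2 := abs_le.mp (hA (x + h))
          have a3 := abs_le.mp (hA (x - h))
          have h2 : |2 * 0 - ψ (x + h) - ψ (x - h)| ≤ 2 * A := by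
            rw [abs_le]
            constructor <;> linarith [a2.1, a2.2, a3.1, a3.2]
          have h3 : x ^ 2 ≤ 4 * h ^ 2 := by
            rw [← sq_abs x]
            nlinarith [hmem.1]
          calc _ ≤ 2 * A * x ^ 2 := by gcongr
            _ ≤ 2 * A * (4 * h ^ 2) := by gcongr
            _ = _ := by ring
        · rw [Set.indicator_of_notMem hmem, hψx]
          have hout : M < |x + h| ∧ M < |x - h| := by
            have hne : M < |(|x| - h)| := by
              by_contra hcon
              have := abs_le.mp (not_lt.mp hcon)
              exact hmem ⟨by linarith [this.2], by linarith [this.1]⟩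
            rcases le_or_gt 0 x with h0 | h0
            · rw [abs_of_nonneg h0] at hne hx
              exact ⟨by rw [abs_of_pos (by linarith)]; linarith, hne⟩
            · rw [abs_of_neg h0] at hne hx
              refine ⟨?_, by rw [abs_of_neg (by linarith)]; linarith⟩
              rw [← abs_neg]
              convert hne using 2
              ring
          rw [hM _ hout.1, hM _ hout.2]
          simp))
    refine hle.trans ?_
    rw [integral_indicator measurableSet_Icc, Measure.restrict_restrict measurableSet_Icc,
      setIntegral_const]
    have hsub : Set.Icc (|x| - M) (|x| + M) ⊆ Set.Ioi 0 :=
      fun t ht => lt_of_lt_of_le (by linarith) ht.1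
    rw [Set.inter_eq_left.mpr hsub]
    rw [Real.volume_real_Icc_of_le (by linarith), smul_eq_mul]
    refine le_of_eq ?_
    ring
  refine ⟨max (Real.pi⁻¹ * I₀ * (1 + 4 * M ^ 2)) (Real.pi⁻¹ * (32 * M * A)), fun x => ?_⟩
  rcases le_or_gt |x| (2 * M) with hx | hx
  · refine le_trans ?_ (le_max_left _ _)
    have : x ^ 2 ≤ 4 * M ^ 2 := by rw [← sq_abs]; nlinarith [abs_nonneg x]
    gcongr
    exact hfirst x
  · refine le_trans ?_ (le_max_right _ _)
    have hx2 : 1 ≤ x ^ 2 := by rw [← sq_abs]; nlinarith [abs_nonneg x]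
    calc _ ≤ Real.pi⁻¹ * (2 * M * (8 * A / x ^ 2)) * (2 * x ^ 2) := by
          gcongr
          · exact hsecond x hx
          · linarith
      _ = _ := by
          have : x ≠ 0 := by rintro rfl; norm_num at hx2
          field_simp
          ring

lemma integrable_absNabla {φ : ℝ → ℝ} (hφ : MemLHalf φ) {ψ : ℝ → ℝ}
    (hψ : ContDiff ℝ (⊤ : ℕ∞) ψ) (hc : HasCompactSupport ψ) :
    Integrable fun x => φ x * absNabla ψ x := by
  obtain ⟨C, hC⟩ := absNabla_bound hψ hc
  refine hφ.mul (StronglyMeasurable.aestronglyMeasurable ?_) hC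
  unfold absNabla
  refine StronglyMeasurable.const_mul ?_ _
  refine StronglyMeasurable.integral_prod_right
    (f := fun x h => (2 * ψ x - ψ (x + h) - ψ (x - h)) / h ^ 2) ?_
  have hcont := hψ.continuous
  have h1 : Continuous fun p : ℝ × ℝ => 2 * ψ p.1 - ψ (p.1 + p.2) - ψ (p.1 - p.2) := by fun_prop
  have h2 : Continuous fun p : ℝ × ℝ => p.2 ^ 2 := by fun_prop
  exact (h1.measurable.div h2.measurable).stronglyMeasurable

lemma Lplus_congr (m : ℕ) {φ φ' : ℝ → ℝ} (h : φ =ᵐ[volume] φ') (ψ : ℝ → ℝ) :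
    Lplus m φ ψ = Lplus m φ' ψ := by
  unfold Lplus
  congr 1
  · exact integral_congr_ae (h.mono fun x hx => by simp only [hx])
  · exact integral_congr_ae (h.mono fun x hx => by simp only [hx])

lemma R_congr (m : ℕ) {φ φ' : ℝ → ℝ} (h : φ =ᵐ[volume] φ') : R m φ = R m φ' := by
  funext x
  unfold R
  congr 1
  exact integral_congr_ae (h.mono fun y hy => by simp only [hy])

lemma Lminus_congr (m : ℕ) {φ φ' : ℝ → ℝ} (h : φ =ᵐ[volume] φ') (ψ : ℝ → ℝ) :
    Lminus m φ ψ = Lminus m φ' ψ := by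
  unfold Lminus
  rw [Lplus_congr m h, R_congr m h]

lemma Lplus_add (m : ℕ) {φ φ' ψ : ℝ → ℝ} (h : MemLHalf φ) (h' : MemLHalf φ')
    (hψ : ContDiff ℝ (⊤ : ℕ∞) ψ) (hc : HasCompactSupport ψ) :
    Lplus m (φ + φ') ψ = Lplus m φ ψ + Lplus m φ' ψ := by
  have e1 := integral_add (integrable_absNabla h hψ hc) (integrable_absNabla h' hψ hc)
  have e2 := integral_add (integrable_potential (m := m) h hψ.continuous hc)
    (integrable_potential (m := m) h' hψ.continuous hc)
  simp only [Lplus, Pi.add_apply, add_mul, mul_add, e1, e2]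
  ring

lemma Lplus_smul (m : ℕ) (c : ℝ) (φ ψ : ℝ → ℝ) : Lplus m (c • φ) ψ = c * Lplus m φ ψ := by
  simp only [Lplus, Pi.smul_apply, smul_eq_mul, mul_sub]
  rw [← integral_const_mul, ← integral_const_mul]
  congr 1 <;> · congr 1; funext x; ring

lemma R_add (m : ℕ) {φ φ' : ℝ → ℝ} (h : MemLHalf φ) (h' : MemLHalf φ') :
    R m (φ + φ') = R m φ + R m φ' := by
  funext x
  have e := integral_add (integrable_kernel (m := m) h x) (integrable_kernel (m := m) h' x)
  simp only [R, Pi.add_apply, mul_add, e]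

lemma R_smul (m : ℕ) (c : ℝ) (φ : ℝ → ℝ) : R m (c • φ) = c • R m φ := by
  funext x
  simp only [R, Pi.smul_apply, smul_eq_mul, mul_left_comm _ c, integral_const_mul]

lemma Lminus_add (m : ℕ) {φ φ' ψ : ℝ → ℝ} (h : MemLHalf φ) (h' : MemLHalf φ')
    (hm : StronglyMeasurable φ) (hm' : StronglyMeasurable φ')
    (hψ : ContDiff ℝ (⊤ : ℕ∞) ψ) (hc : HasCompactSupport ψ) :
    Lminus m (φ + φ') ψ = Lminus m φ ψ + Lminus m φ' ψ := by
  have e := integral_add (integrable_R_mul (m := m) h hm hψ.continuous hc)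
    (integrable_R_mul (m := m) h' hm' hψ.continuous hc)
  simp only [Lminus, Lplus_add m h h' hψ hc, R_add m h h', Pi.add_apply, add_mul, e]
  ring

lemma Lminus_smul (m : ℕ) (c : ℝ) (φ ψ : ℝ → ℝ) : Lminus m (c • φ) ψ = c * Lminus m φ ψ := by
  simp only [Lminus, Lplus_smul, R_smul, Pi.smul_apply, smul_eq_mul, mul_assoc,
    integral_const_mul, mul_add]

lemma seminormSq_congr {φ φ' : ℝ → ℝ} (h : φ =ᵐ[volume] φ') :
    seminormSq φ = seminormSq φ' := by
  unfold seminormSq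
  congr 1
  refine lintegral_congr_ae ?_
  have h1 : ∀ᵐ p : ℝ × ℝ, φ p.1 = φ' p.1 := Measure.quasiMeasurePreserving_fst.ae h
  have h2 : ∀ᵐ p : ℝ × ℝ, φ p.2 = φ' p.2 := Measure.quasiMeasurePreserving_snd.ae h
  filter_upwards [h1, h2] with p hp1 hp2
  rw [hp1, hp2]

lemma seminormSq_add_lt_top {φ φ' : ℝ → ℝ} (hm : StronglyMeasurable φ)
    (h : seminormSq φ < ⊤) (h' : seminormSq φ' < ⊤) : seminormSq (φ + φ') < ⊤ := by
  have hc : ENNReal.ofReal (2 * Real.pi)⁻¹ ≠ 0 := by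
    rw [Ne, ENNReal.ofReal_eq_zero, not_le]; positivity
  have key (u : ℝ → ℝ) : seminormSq u < ⊤ ↔
      ∫⁻ p : ℝ × ℝ, ENNReal.ofReal (|u p.1 - u p.2| ^ 2 / |p.1 - p.2| ^ 2) < ⊤ := by
    unfold seminormSq
    rw [ENNReal.mul_lt_top_iff]
    simp only [ENNReal.ofReal_lt_top, true_and, hc, false_or]
    constructor
    · rintro (h | h)
      · exact h
      · rw [h]; exact ENNReal.zero_lt_top
    · exact Or.inl
  rw [key] at h h' ⊢
  have hmeas : Measurable fun p : ℝ × ℝ =>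
      ENNReal.ofReal (|φ p.1 - φ p.2| ^ 2 / |p.1 - p.2| ^ 2) := by
    have := hm.measurable
    refine ENNReal.measurable_ofReal.comp (Measurable.div ?_ ?_)
    · exact (((this.comp measurable_fst).sub (this.comp measurable_snd)).abs).pow_const 2
    · exact ((measurable_fst.sub measurable_snd).abs).pow_const 2
  have hle (p : ℝ × ℝ) :
      ENNReal.ofReal (|(φ + φ') p.1 - (φ + φ') p.2| ^ 2 / |p.1 - p.2| ^ 2) ≤
        2 * (ENNReal.ofReal (|φ p.1 - φ p.2| ^ 2 / |p.1 - p.2| ^ 2) +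
          ENNReal.ofReal (|φ' p.1 - φ' p.2| ^ 2 / |p.1 - p.2| ^ 2)) := by
    rw [← ENNReal.ofReal_add (by positivity) (by positivity),
      show (2 : ENNReal) = ENNReal.ofReal 2 by simp, ← ENNReal.ofReal_mul (by norm_num)]
    refine ENNReal.ofReal_le_ofReal ?_
    rw [← add_div, mul_div_assoc']
    gcongr
    simp only [Pi.add_apply, sq_abs]
    nlinarith [sq_nonneg ((φ p.1 - φ p.2) - (φ' p.1 - φ' p.2))]
  refine (lintegral_mono hle).trans_lt ?_
  rw [lintegral_const_mul' _ _ (by simp), lintegral_add_left hmeas]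
  exact ENNReal.mul_lt_top (by simp) (ENNReal.add_lt_top.mpr ⟨h, h'⟩)

lemma seminormSq_smul (c : ℝ) (φ : ℝ → ℝ) :
    seminormSq (c • φ) = ENNReal.ofReal (c ^ 2) * seminormSq φ := by
  unfold seminormSq
  rw [mul_left_comm, ← lintegral_const_mul' (ENNReal.ofReal (c ^ 2)) _ (by simp)]
  congr 1
  refine lintegral_congr fun p => ?_
  rw [← ENNReal.ofReal_mul (by positivity)]
  congr 1
  simp only [Pi.smul_apply, smul_eq_mul, sq_abs]
  ring

lemma MemLHalf.congr {φ φ' : ℝ → ℝ} (h : MemLHalf φ) (e : φ =ᵐ[volume] φ') : MemLHalf φ' :=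
  Integrable.congr h (e.mono fun x hx => by simp only [hx])

lemma MemLHalf.add {φ φ' : ℝ → ℝ} (h : MemLHalf φ) (h' : MemLHalf φ') : MemLHalf (φ + φ') := by
  refine (Integrable.add h h').congr (Filter.Eventually.of_forall fun x => ?_)
  simp [add_div]

lemma MemLHalf.smul {φ : ℝ → ℝ} (c : ℝ) (h : MemLHalf φ) : MemLHalf (c • φ) := by
  refine (Integrable.const_mul h c).congr (Filter.Eventually.of_forall fun x => ?_)
  simp [mul_div_assoc]

/-! ### The spaces -/

/-- `Ḣ^{1/2}(ℝ)`: the (classes of) real-valued `φ ∈ L_{1/2}(ℝ)` with `‖φ‖_{Ḣ^{1/2}} < ∞`. -/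
def HdotHalf : Submodule ℝ (ℝ →ₘ[volume] ℝ) where
  carrier := {φ | MemLHalf φ ∧ seminormSq φ < ⊤}
  zero_mem' := by
    have e : ((0 : ℝ →ₘ[volume] ℝ) : ℝ → ℝ) =ᵐ[volume] (0 : ℝ → ℝ) := AEEqFun.coeFn_zero
    refine ⟨MemLHalf.congr ?_ e.symm, ?_⟩
    · simp [MemLHalf]
    · rw [seminormSq_congr e]; simp [seminormSq]
  add_mem' := by
    rintro φ φ' ⟨h1, h2⟩ ⟨h1', h2'⟩
    have e := AEEqFun.coeFn_add φ φ'
    refine ⟨(h1.add h1').congr e.symm, ?_⟩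
    rw [seminormSq_congr e]
    exact seminormSq_add_lt_top φ.stronglyMeasurable h2 h2'
  smul_mem' := by
    rintro c φ ⟨h1, h2⟩
    have e := AEEqFun.coeFn_smul c φ
    refine ⟨(h1.smul c).congr e.symm, ?_⟩
    rw [seminormSq_congr e, seminormSq_smul]
    exact ENNReal.mul_lt_top (by simp) h2

/-- `𝒩(L₊) = {φ ∈ Ḣ^{1/2}(ℝ) : L₊ φ = 0}`, the equation being understood in `𝒟'(ℝ)`. -/
def NLplus (m : ℕ) : Submodule ℝ (ℝ →ₘ[volume] ℝ) where
  carrier := {φ | φ ∈ HdotHalf ∧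
    ∀ ψ : ℝ → ℝ, ContDiff ℝ (⊤ : ℕ∞) ψ → HasCompactSupport ψ → Lplus m φ ψ = 0}
  zero_mem' := by
    refine ⟨HdotHalf.zero_mem, fun ψ _ _ => ?_⟩
    have e : ((0 : ℝ →ₘ[volume] ℝ) : ℝ → ℝ) =ᵐ[volume] (0 : ℝ → ℝ) := AEEqFun.coeFn_zero
    rw [Lplus_congr m e]
    simp [Lplus]
  add_mem' := by
    rintro φ φ' ⟨h, e⟩ ⟨h', e'⟩
    refine ⟨HdotHalf.add_mem h h', fun ψ hψ hc => ?_⟩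
    rw [Lplus_congr m (AEEqFun.coeFn_add φ φ'), Lplus_add m h.1 h'.1 hψ hc, e ψ hψ hc,
      e' ψ hψ hc, add_zero]
  smul_mem' := by
    rintro c φ ⟨h, e⟩
    refine ⟨HdotHalf.smul_mem c h, fun ψ hψ hc => ?_⟩
    rw [Lplus_congr m (AEEqFun.coeFn_smul c φ), Lplus_smul, e ψ hψ hc, mul_zero]

/-- `𝒩(L₋) = {φ ∈ Ḣ^{1/2}(ℝ) : L₋ φ = 0}`, the equation being understood in `𝒟'(ℝ)`. -/
def NLminus (m : ℕ) : Submodule ℝ (ℝ →ₘ[volume] ℝ) where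
  carrier := {φ | φ ∈ HdotHalf ∧
    ∀ ψ : ℝ → ℝ, ContDiff ℝ (⊤ : ℕ∞) ψ → HasCompactSupport ψ → Lminus m φ ψ = 0}
  zero_mem' := by
    refine ⟨HdotHalf.zero_mem, fun ψ _ _ => ?_⟩
    have e : ((0 : ℝ →ₘ[volume] ℝ) : ℝ → ℝ) =ᵐ[volume] (0 : ℝ → ℝ) := AEEqFun.coeFn_zero
    rw [Lminus_congr m e]
    simp [Lminus, Lplus, R]
  add_mem' := by
    rintro φ φ' ⟨h, e⟩ ⟨h', e'⟩
    refine ⟨HdotHalf.add_mem h h', fun ψ hψ hc => ?_⟩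
    rw [Lminus_congr m (AEEqFun.coeFn_add φ φ'),
      Lminus_add m h.1 h'.1 φ.stronglyMeasurable φ'.stronglyMeasurable hψ hc, e ψ hψ hc,
      e' ψ hψ hc, add_zero]
  smul_mem' := by
    rintro c φ ⟨h, e⟩
    refine ⟨HdotHalf.smul_mem c h, fun ψ hψ hc => ?_⟩
    rw [Lminus_congr m (AEEqFun.coeFn_smul c φ), Lminus_smul, e ψ hψ hc, mul_zero]

/-- `f_k` as a class of functions modulo null sets. -/
def fClass (k : ℕ) : ℝ →ₘ[volume] ℝ := AEEqFun.mk (f k) (continuous_f k).aestronglyMeasurable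

/-- `g_k` as a class of functions modulo null sets. -/
def gClass (k : ℕ) : ℝ →ₘ[volume] ℝ := AEEqFun.mk (g k) (continuous_g k).aestronglyMeasurable

/-- Nondegeneracy of the linearized operator `L = diag(L₊, L₋)` around `Q_m`: the nullspaces
have exactly the dimensions `2` and `2m + 1` that are forced by the symmetries and by the
number of free parameters of the half-harmonic maps of degree `m`. -/
def Nondegenerate (m : ℕ) : Prop :=
  Module.finrank ℝ (NLplus m) = 2 ∧ Module.finrank ℝ (NLminus m) = 2 * m + 1

/-- `φ` is a resonance for an operator with nullspace `N` in `Ḣ^{1/2}`: it belongs to `N`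
but not to `L²(ℝ)`. -/
def IsResonance (N : Submodule ℝ (ℝ →ₘ[volume] ℝ)) (φ : ℝ →ₘ[volume] ℝ) : Prop :=
  φ ∈ N ∧ φ ∈ HdotHalf ∧ φ ∉ Lp ℝ 2 (volume : Measure ℝ)

end HalfHarmonic

end

/-!
`z x = i (x - i) / (x + i)` identifies the line with the circle punctured at `i = z(∞)`, arc length
becomes `weight x dx` with `weight x = 2 / (1 + x²)`, and `1 / (x - y)²` becomes
`weight x weight y / |z x - z y|²`. Replacing `z y` by `r z y` turns the latter into a multiple of
the Poisson kernel; letting `r → 1` gives `|∇| ℓ(z ^ k) = k weight ℓ(z ^ k)` for every real-linear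
`ℓ : ℂ → ℝ`. Moreover `|∂Q_m| = m weight`, and since `(z x ^ m - z y ^ m) / (z x - z y)` is a
geometric sum, `R ℓ(z ^ k) = max (m - k) 0 weight ℓ(z ^ k)`. So `weight⁻¹ L_±` is diagonal in the
trigonometric system, with eigenvalue `k - m` for `L_+` and `max (k - m) 0` for `L_-`.

For the reverse inclusions, test `L_± φ = 0` against `ℓ(z ^ k) - ℓ(i ^ k)`, which vanishes at
infinity and so is a limit of test functions. The correction contributes the mean `∫ weight φ`: for
`L_-` its coefficient is the eigenvalue `0` of the constants, and for `L_+` the case `k = m` shows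
that the mean is zero, because `i ^ m ≠ 0`. Hence `φ` is orthogonal to every `ℓ(z ^ k)` with nonzero
eigenvalue, and completeness of the trigonometric system identifies the nullspaces. At infinity
`ℓ(z ^ m)` tends to `ℓ(i ^ m)`, so it is a resonance as soon as this value is nonzero.
-/

noncomputable section

namespace HalfHarmonic

open Filter Topology

/-! ### The circle and its powers -/

/-- The arc length density of the unit circle in the coordinate `x`: `z' = i weight z`, and
`∫ weight φ` is the integral of `φ` over the circle. -/
def weight (x : ℝ) : ℝ := 2 / (1 + x ^ 2)

lemma weight_pos (x : ℝ) : 0 < weight x := by unfold weight; positivity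

lemma continuous_weight : Continuous weight := by
  unfold weight
  exact continuous_const.div (by fun_prop) fun x => by positivity

lemma integrable_weight : Integrable weight := by
  change Integrable fun x : ℝ => 2 / (1 + x ^ 2)
  simpa only [div_eq_mul_inv] using integrable_inv_one_add_sq.const_mul 2

lemma integral_weight : ∫ x, weight x = 2 * Real.pi := by
  simp only [weight, div_eq_mul_inv]
  rw [integral_const_mul, integral_univ_inv_one_add_sq]

lemma memLHalf_of_bounded {φ : ℝ → ℝ} (hφ : AEStronglyMeasurable φ) {C : ℝ}
    (hC : ∀ x, |φ x| ≤ C) : MemLHalf φ := by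
  simpa only [MemLHalf, div_eq_inv_mul] using
    integrable_inv_one_add_sq.mul_bdd hφ (Eventually.of_forall hC)

lemma MemLHalf.integrable_weight_mul {φ : ℝ → ℝ} (hφ : MemLHalf φ) :
    Integrable fun x => weight x * φ x := by
  simpa only [weight, mul_div_assoc', div_mul_eq_mul_div] using hφ.const_mul 2

lemma norm_z_sub_sq (x y : ℝ) : ‖z x - z y‖ ^ 2 = (x - y) ^ 2 * (weight x * weight y) := by
  rw [norm_z_sub, sq_abs]
  unfold weight
  field_simp
  ring

lemma ofReal_add_I_ne_zero (x : ℝ) : (x : ℂ) + Complex.I ≠ 0 := fun h => by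
  simpa using congrArg Complex.im h

lemma z_ne_zero (x : ℝ) : z x ≠ 0 := norm_ne_zero_iff.mp (by rw [norm_z]; exact one_ne_zero)

lemma norm_z_zpow (x : ℝ) (n : ℤ) : ‖z x ^ n‖ = 1 := by
  rw [norm_zpow, norm_z, one_zpow]

lemma z_injective : Function.Injective z := by
  intro x y h
  have hsq : (x - y) ^ 2 * (weight x * weight y) = 0 := by
    rw [← norm_z_sub_sq, h, sub_self, norm_zero, zero_pow two_ne_zero]
  have hw : weight x * weight y ≠ 0 := (mul_pos (weight_pos x) (weight_pos y)).ne'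
  exact sub_eq_zero.mp (pow_eq_zero_iff two_ne_zero |>.mp ((mul_eq_zero.mp hsq).resolve_right hw))

lemma z_sub_I (x : ℝ) : z x - Complex.I = 2 * ((x : ℂ) + Complex.I)⁻¹ := by
  have := ofReal_add_I_ne_zero x
  unfold z
  field_simp
  linear_combination -2 * Complex.I_sq

lemma tendsto_z_cocompact : Tendsto z (cocompact ℝ) (𝓝 Complex.I) := by
  have hinv : Tendsto (fun x : ℝ => 2 * ((x : ℂ) + Complex.I)⁻¹) (cocompact ℝ) (𝓝 (2 * 0)) := by
    refine (tendsto_inv₀_cobounded.comp ?_).const_mul 2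
    rw [← Metric.cobounded_eq_cocompact]
    exact tendsto_add_const_cobounded _ |>.comp (RCLike.tendsto_ofReal_cobounded_cobounded ℂ)
  rw [mul_zero] at hinv
  simpa only [← z_sub_I, sub_add_cancel, zero_add] using hinv.add_const Complex.I

lemma hasDerivAt_z (x : ℝ) : HasDerivAt z (Complex.I * weight x * z x) x := by
  have hx : HasDerivAt (fun x : ℝ => (x : ℂ)) 1 x := Complex.ofRealCLM.hasDerivAt
  have hne := ofReal_add_I_ne_zero x
  have hne' : (x : ℂ) - Complex.I ≠ 0 := fun h => by simpa using congrArg Complex.im h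
  have hfactor : 1 + (x : ℂ) ^ 2 = ((x : ℂ) + Complex.I) * ((x : ℂ) - Complex.I) := by
    linear_combination Complex.I_sq
  refine (((hx.sub_const Complex.I).div (hx.add_const Complex.I) hne).const_mul
    Complex.I).congr_deriv ?_
  unfold weight z
  push_cast
  rw [hfactor]
  field_simp
  ring_nf

lemma hasDerivAt_z_zpow (n : ℤ) (x : ℝ) :
    HasDerivAt (fun x => z x ^ n) (Complex.I * n * (weight x * z x ^ n)) x := by
  have hz := z_ne_zero x
  refine ((hasDerivAt_zpow n (z x) (Or.inl hz)).comp x (hasDerivAt_z x)).congr_deriv ?_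
  rw [zpow_sub_one₀ hz]
  field_simp

lemma continuous_z_zpow (n : ℤ) : Continuous fun x => z x ^ n :=
  continuous_iff_continuousAt.mpr fun x => (hasDerivAt_z_zpow n x).continuousAt

lemma integrable_weight_mul_zpow (n : ℤ) : Integrable fun x => (weight x : ℂ) * z x ^ n :=
  (integrable_weight.ofReal (𝕜 := ℂ)).mul_bdd (continuous_z_zpow n).aestronglyMeasurable
    (Eventually.of_forall fun x => (norm_z_zpow x n).le)

lemma integral_weight_mul_zpow (n : ℤ) :
    ∫ x, (weight x : ℂ) * z x ^ n = if n = 0 then 2 * (Real.pi : ℂ) else 0 := by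
  split_ifs with hn
  · subst hn
    simpa [integral_weight] using integral_ofReal (𝕜 := ℂ) (f := weight) (μ := volume)
  · -- `weight * z ^ n` is, up to the factor `i n`, the derivative of `z ^ n`, and `z` has the
    -- same limit at `-∞` and at `∞`.
    have hlim : Tendsto (fun x => z x ^ n) (cocompact ℝ) (𝓝 (Complex.I ^ n)) :=
      (continuousAt_zpow₀ _ n (Or.inl Complex.I_ne_zero)).tendsto.comp tendsto_z_cocompact
    have h := integral_of_hasDerivAt_of_tendsto (hasDerivAt_z_zpow n)
      ((integrable_weight_mul_zpow n).const_mul _)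
      (hlim.mono_left atBot_le_cocompact) (hlim.mono_left atTop_le_cocompact)
    rw [integral_const_mul, sub_self] at h
    exact (mul_eq_zero.mp h).resolve_left
      (mul_ne_zero Complex.I_ne_zero (by exact_mod_cast hn))

lemma norm_deriv_Q (m : ℕ) (x : ℝ) : ‖deriv (Q m) x‖ = m * weight x := by
  set d := Complex.I * m * (weight x * z x ^ m) with hd
  have hz : HasDerivAt (fun x => z x ^ m) d x := by simpa using hasDerivAt_z_zpow (m : ℤ) x
  have hcoord : HasDerivAt (fun x => (![f m x, g m x, 0] : Fin 3 → ℝ)) ![d.re, d.im, 0] x := by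
    rw [hasDerivAt_pi]
    intro i
    fin_cases i
    · exact Complex.reCLM.hasFDerivAt.comp_hasDerivAt x hz
    · exact Complex.imCLM.hasFDerivAt.comp_hasDerivAt x hz
    · exact hasDerivAt_const x (0 : ℝ)
  have hQ : HasDerivAt (Q m) !₂[d.re, d.im, 0] x :=
    (PiLp.continuousLinearEquiv 2 ℝ fun _ : Fin 3 =>
      ℝ).symm.toContinuousLinearMap.hasFDerivAt.comp_hasDerivAt x hcoord
  have hnorm : ‖d‖ = m * weight x := by simp [hd, norm_z, abs_of_pos (weight_pos x)]
  rw [hQ.deriv, EuclideanSpace.norm_eq, ← hnorm, Complex.norm_eq_sqrt_sq_add_sq]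
  simp [Fin.sum_univ_three]

lemma map_ofReal_mul (ℓ : ℂ →L[ℝ] ℝ) (c : ℝ) (u : ℂ) : ℓ (c * u) = c * ℓ u := by
  rw [← Complex.real_smul, map_smul, smul_eq_mul]

/-- The function `ℓ (z ^ k)` of frequency `k`, for a real-linear functional `ℓ`; `f k` and `g k`
are the cases `ℓ = Re` and `ℓ = Im`. -/
def mode (ℓ : ℂ →L[ℝ] ℝ) (k : ℕ) (x : ℝ) : ℝ := ℓ (z x ^ k)

lemma f_eq_mode (k : ℕ) : f k = mode Complex.reCLM k := rfl

lemma g_eq_mode (k : ℕ) : g k = mode Complex.imCLM k := rfl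

lemma continuous_mode (ℓ : ℂ →L[ℝ] ℝ) (k : ℕ) : Continuous (mode ℓ k) :=
  ℓ.continuous.comp (continuous_z.pow k)

lemma abs_mode_le (ℓ : ℂ →L[ℝ] ℝ) (k : ℕ) (x : ℝ) : |mode ℓ k x| ≤ ‖ℓ‖ := by
  simpa only [mode, norm_pow, norm_z, one_pow, mul_one, Real.norm_eq_abs] using
    ℓ.le_opNorm (z x ^ k)

lemma integrable_mul_mode {v : ℝ → ℝ} (hv : Integrable v) (ℓ : ℂ →L[ℝ] ℝ) (k : ℕ) :
    Integrable fun x => v x * mode ℓ k x :=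
  hv.mul_bdd (continuous_mode ℓ k).aestronglyMeasurable (Eventually.of_forall (abs_mode_le ℓ k))

lemma tendsto_mode_cocompact (ℓ : ℂ →L[ℝ] ℝ) (k : ℕ) :
    Tendsto (mode ℓ k) (cocompact ℝ) (𝓝 (ℓ (Complex.I ^ k))) :=
  (ℓ.continuous.tendsto _).comp (tendsto_z_cocompact.pow k)

lemma integral_weight_mul_mode (ℓ : ℂ →L[ℝ] ℝ) {k : ℕ} (hk : k ≠ 0) :
    ∫ x, weight x * mode ℓ k x = 0 := by
  have h := ℓ.integral_comp_comm (integrable_weight_mul_zpow k)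
  rw [integral_weight_mul_zpow, if_neg (by exact_mod_cast hk), map_zero] at h
  simpa only [mode, map_ofReal_mul, zpow_natCast] using h

lemma kernel_comm (m : ℕ) (x y : ℝ) : kernel m x y = kernel m y x := by
  unfold kernel
  rw [norm_sub_rev, abs_sub_comm]

lemma normSq_pow_sub_pow {a b : ℂ} (ha : ‖a‖ = 1) (hb : ‖b‖ = 1) (m : ℕ) :
    (‖a ^ m - b ^ m‖ ^ 2 : ℂ) = ‖a - b‖ ^ 2 * ∑ j ∈ Finset.range m, ∑ l ∈ Finset.range m,
      a ^ ((j : ℤ) - l) * b ^ ((l : ℤ) - j) := by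
  have ha0 : a ≠ 0 := norm_ne_zero_iff.mp (by simp [ha])
  have hb0 : b ≠ 0 := norm_ne_zero_iff.mp (by simp [hb])
  rw [← (Commute.all a b).geom_sum₂_mul m, norm_mul, mul_comm]
  push_cast
  rw [mul_pow, ← Complex.conj_mul' (Finset.sum _ _), mul_comm (starRingEnd ℂ _), map_sum,
    Finset.sum_mul_sum]
  congr 1
  refine Finset.sum_congr rfl fun j hj => Finset.sum_congr rfl fun l hl => ?_
  obtain ⟨p, rfl⟩ := Nat.exists_eq_add_of_lt (Finset.mem_range.mp hj)
  obtain ⟨q, hq⟩ := Nat.exists_eq_add_of_lt (Finset.mem_range.mp hl)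
  have hp : j + p + 1 - 1 - j = p := by omega
  have hq' : j + p + 1 - 1 - l = q := by omega
  have hzpow : (l : ℤ) - j = (p : ℤ) - q := by omega
  rw [map_mul, map_pow, map_pow, ← Complex.inv_eq_conj ha, ← Complex.inv_eq_conj hb, hp, hq',
    hzpow, zpow_sub₀ ha0, zpow_sub₀ hb0]
  simp only [inv_pow, zpow_natCast]
  ring

lemma kernel_eq_sum (m : ℕ) {x y : ℝ} (hxy : x ≠ y) :
    (kernel m x y : ℂ) = weight x * weight y * ∑ j ∈ Finset.range m, ∑ l ∈ Finset.range m,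
      z x ^ ((j : ℤ) - l) * z y ^ ((l : ℤ) - j) := by
  have hne : (x : ℂ) - y ≠ 0 := sub_ne_zero.mpr (by exact_mod_cast hxy)
  unfold kernel
  rw [norm_Q_sub, sq_abs]
  push_cast
  rw [normSq_pow_sub_pow (norm_z x) (norm_z y), ← Complex.ofReal_pow, norm_z_sub_sq]
  push_cast
  field_simp

lemma integral_kernel_mul_pow (m k : ℕ) (x : ℝ) :
    ∫ y, (kernel m x y : ℂ) * z y ^ k = 2 * Real.pi * ((m - k : ℕ) * weight x * z x ^ k) := by
  have hexpand : ∀ᵐ y : ℝ, (kernel m x y : ℂ) * z y ^ k =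
      ∑ j ∈ Finset.range m, ∑ l ∈ Finset.range m,
        weight x * z x ^ ((j : ℤ) - l) * (weight y * z y ^ ((l : ℤ) - j + k)) := by
    filter_upwards [Measure.ae_ne volume x] with y hy
    simp only [kernel_eq_sum m hy.symm, zpow_add₀ (z_ne_zero y), zpow_natCast, Finset.mul_sum,
      Finset.sum_mul]
    exact Finset.sum_congr rfl fun j _ => Finset.sum_congr rfl fun l _ => by ring
  have hterm (j l : ℕ) :
      ∫ y, weight x * z x ^ ((j : ℤ) - l) * (weight y * z y ^ ((l : ℤ) - j + k)) =
        if j = l + k then 2 * Real.pi * (weight x * z x ^ k) else 0 := by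
    rw [integral_const_mul, integral_weight_mul_zpow]
    by_cases h : j = l + k
    · have hj : (j : ℤ) - l = k := by omega
      rw [if_pos (by omega), if_pos h, hj, zpow_natCast]
      ring
    · rw [if_neg (by omega), if_neg h, mul_zero]
  have hcount : {l ∈ Finset.range m | l + k < m} = Finset.range (m - k) := by
    ext l
    simp only [Finset.mem_filter, Finset.mem_range]
    omega
  have hint (j l : ℕ) := (integrable_weight_mul_zpow ((l : ℤ) - j + k)).const_mul
    (weight x * z x ^ ((j : ℤ) - l))
  rw [integral_congr_ae hexpand,
    integral_finsetSum _ fun j _ => integrable_finsetSum _ fun l _ => hint j l]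
  simp only [integral_finsetSum _ fun l _ => hint _ l, hterm]
  rw [Finset.sum_comm]
  simp only [Finset.sum_ite_eq', Finset.mem_range]
  rw [← Finset.sum_filter, hcount, Finset.sum_const, Finset.card_range, nsmul_eq_mul]
  ring

lemma R_mode (m : ℕ) (ℓ : ℂ →L[ℝ] ℝ) (k : ℕ) (x : ℝ) :
    R m (mode ℓ k) x = (m - k : ℕ) * (weight x * mode ℓ k x) := by
  have hkernel : Integrable fun y => kernel m x y := by
    simpa only [mul_one] using integrable_kernel (m := m) (memLHalf_of_bounded (C := 1)
      (aestronglyMeasurable_const (b := (1 : ℝ))) fun _ => by simp) x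
  have hint : Integrable fun y => (kernel m x y : ℂ) * z y ^ k :=
    (hkernel.ofReal (𝕜 := ℂ)).mul_bdd (c := 1) (continuous_z.pow k).aestronglyMeasurable
      (Eventually.of_forall fun y => by rw [norm_pow, norm_z, one_pow])
  have hvalue : 2 * (Real.pi : ℂ) * ((m - k : ℕ) * weight x * z x ^ k) =
      ((2 * Real.pi * ((m - k : ℕ) * weight x) : ℝ) : ℂ) * z x ^ k := by
    push_cast; ring
  have h := ℓ.integral_comp_comm hint
  rw [integral_kernel_mul_pow, hvalue, map_ofReal_mul] at h
  simp only [map_ofReal_mul] at h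
  unfold R mode
  rw [h]
  field_simp

/-! ### The energy form -/

/-- The difference quotient of `φ`, as a function on the plane; it vanishes on the diagonal. -/
def diffQuot (φ : ℝ → ℝ) (p : ℝ × ℝ) : ℝ := (φ p.1 - φ p.2) / (p.1 - p.2)

/-- The bilinear form of `|∇|`, whose quadratic form is `seminormSq`. -/
def energy (φ ψ : ℝ → ℝ) : ℝ := (2 * Real.pi)⁻¹ * ∫ p : ℝ × ℝ, diffQuot φ p * diffQuot ψ p

lemma energy_comm (φ ψ : ℝ → ℝ) : energy φ ψ = energy ψ φ := by
  simp only [energy, mul_comm]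

lemma energy_sub_const (φ ψ : ℝ → ℝ) (c : ℝ) : energy φ (fun x => ψ x - c) = energy φ ψ := by
  simp only [energy, diffQuot, sub_sub_sub_cancel_right]

lemma measurable_diffQuot {φ : ℝ → ℝ} (hφ : Measurable φ) : Measurable (diffQuot φ) :=
  ((hφ.comp measurable_fst).sub (hφ.comp measurable_snd)).div (measurable_fst.sub measurable_snd)

lemma seminormSq_lt_top_iff {φ : ℝ → ℝ} (hφ : Measurable φ) :
    seminormSq φ < ⊤ ↔ MemLp (diffQuot φ) 2 := by
  have hm := measurable_diffQuot hφ
  have hc : ENNReal.ofReal (2 * Real.pi)⁻¹ ≠ 0 := by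
    rw [Ne, ENNReal.ofReal_eq_zero, not_le]; positivity
  have hsq (p : ℝ × ℝ) : ENNReal.ofReal (|φ p.1 - φ p.2| ^ 2 / |p.1 - p.2| ^ 2) =
      ‖diffQuot φ p ^ 2‖ₑ := by
    rw [Real.enorm_eq_ofReal (sq_nonneg _), diffQuot, div_pow, sq_abs, sq_abs]
  rw [memLp_two_iff_integrable_sq hm.aestronglyMeasurable, Integrable, HasFiniteIntegral,
    and_iff_right (hm.pow_const 2).aestronglyMeasurable, seminormSq]
  simp only [hsq]
  rw [ENNReal.mul_lt_top_iff, and_iff_right ENNReal.ofReal_lt_top, or_iff_left_of_imp]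
  rintro (h | h)
  · exact absurd h hc
  · rw [h]; exact ENNReal.zero_lt_top

/-- The representatives of the elements of `Ḣ^{1/2}(ℝ)`. Unlike `HdotHalf` this is a predicate on
functions, not on classes modulo null sets. -/
structure MemHdotHalf (φ : ℝ → ℝ) : Prop where
  measurable : Measurable φ
  memLHalf : MemLHalf φ
  memLp_diffQuot : MemLp (diffQuot φ) 2

lemma memHdotHalf_coe {φ : ℝ →ₘ[volume] ℝ} (hφ : φ ∈ HdotHalf) : MemHdotHalf φ where
  measurable := φ.measurable
  memLHalf := hφ.1
  memLp_diffQuot := (seminormSq_lt_top_iff φ.measurable).mp hφ.2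

lemma MemHdotHalf.mk_mem {φ : ℝ → ℝ} (hφ : MemHdotHalf φ) :
    AEEqFun.mk φ hφ.measurable.aestronglyMeasurable ∈ HdotHalf :=
  have e := AEEqFun.coeFn_mk φ hφ.measurable.aestronglyMeasurable
  ⟨hφ.memLHalf.congr e.symm, by
    rw [seminormSq_congr e]
    exact (seminormSq_lt_top_iff hφ.measurable).mpr hφ.memLp_diffQuot⟩

/-- `ψ` is Lipschitz with constant `C` as a function on the unit circle with the chordal distance,
`ℝ` being identified with a subset of the circle by `z`. -/
def IsChordalLipschitz (C : ℝ) (ψ : ℝ → ℝ) : Prop := ∀ x y, |ψ x - ψ y| ≤ C * ‖z x - z y‖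

namespace IsChordalLipschitz

variable {C : ℝ} {ψ : ℝ → ℝ}

lemma nonneg (h : IsChordalLipschitz C ψ) : 0 ≤ C :=
  have hpos : 0 < ‖z 0 - z 1‖ := norm_sub_pos_iff.mpr (z_injective.ne zero_ne_one)
  nonneg_of_mul_nonneg_left ((abs_nonneg _).trans (h 0 1)) hpos

lemma abs_diffQuot_le (h : IsChordalLipschitz C ψ) (p : ℝ × ℝ) :
    |diffQuot ψ p| ≤ C * √(weight p.1 * weight p.2) := by
  have hchord : ‖z p.1 - z p.2‖ = √(weight p.1 * weight p.2) * |p.1 - p.2| := by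
    rw [← Real.sqrt_sq (norm_nonneg _), norm_z_sub_sq, Real.sqrt_mul (sq_nonneg _),
      Real.sqrt_sq_eq_abs, mul_comm]
  rw [diffQuot, abs_div]
  refine div_le_of_le_mul₀ (abs_nonneg _) (mul_nonneg h.nonneg (Real.sqrt_nonneg _)) ?_
  rw [mul_assoc, ← hchord]
  exact h _ _

lemma sub_const (h : IsChordalLipschitz C ψ) (c : ℝ) : IsChordalLipschitz C fun x => ψ x - c := by
  simpa only [IsChordalLipschitz, sub_sub_sub_cancel_right] using h

lemma abs_le_of_tendsto_zero (h : IsChordalLipschitz C ψ) (h0 : Tendsto ψ (cocompact ℝ) (𝓝 0))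
    (x : ℝ) : |ψ x| ≤ 2 * C := by
  have hdiff (y : ℝ) : |ψ x - ψ y| ≤ 2 * C := by
    have hdiam : ‖z x - z y‖ ≤ 2 := (norm_sub_le _ _).trans (by rw [norm_z, norm_z]; norm_num)
    exact (h x y).trans (by nlinarith [h.nonneg])
  have hlim : Tendsto (fun y => |ψ x - ψ y|) (cocompact ℝ) (𝓝 |ψ x - 0|) :=
    (tendsto_const_nhds.sub h0).abs
  rw [sub_zero] at hlim
  exact le_of_tendsto' hlim hdiff

end IsChordalLipschitz

lemma memLp_sqrt_weight_mul_weight :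
    MemLp (fun p : ℝ × ℝ => √(weight p.1 * weight p.2)) 2 := by
  have hc : Continuous fun p : ℝ × ℝ => √(weight p.1 * weight p.2) :=
    ((continuous_weight.comp continuous_fst).mul (continuous_weight.comp continuous_snd)).sqrt
  rw [memLp_two_iff_integrable_sq hc.aestronglyMeasurable]
  simpa only [Real.sq_sqrt (mul_pos (weight_pos _) (weight_pos _)).le] using!
    integrable_weight.mul_prod integrable_weight

lemma IsChordalLipschitz.memLp_diffQuot {C : ℝ} {ψ : ℝ → ℝ} (h : IsChordalLipschitz C ψ)
    (hψ : Measurable ψ) : MemLp (diffQuot ψ) 2 :=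
  (memLp_sqrt_weight_mul_weight.const_mul C).mono' (measurable_diffQuot hψ).aestronglyMeasurable
    (Eventually.of_forall h.abs_diffQuot_le)

lemma isChordalLipschitz_mode (ℓ : ℂ →L[ℝ] ℝ) (k : ℕ) :
    IsChordalLipschitz (‖ℓ‖ * k) (mode ℓ k) := fun x y => calc
  |mode ℓ k x - mode ℓ k y| = ‖ℓ (z x ^ k - z y ^ k)‖ := by rw [map_sub, Real.norm_eq_abs]; rfl
  _ ≤ ‖ℓ‖ * ‖z x ^ k - z y ^ k‖ := ℓ.le_opNorm _
  _ ≤ ‖ℓ‖ * (k * ‖z x - z y‖) := by gcongr; exact norm_pow_sub_le (norm_z x) (norm_z y) k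
  _ = ‖ℓ‖ * k * ‖z x - z y‖ := (mul_assoc _ _ _).symm

lemma memHdotHalf_mode (ℓ : ℂ →L[ℝ] ℝ) (k : ℕ) : MemHdotHalf (mode ℓ k) where
  measurable := (continuous_mode ℓ k).measurable
  memLHalf := memLHalf_of_bounded (continuous_mode ℓ k).aestronglyMeasurable (abs_mode_le ℓ k)
  memLp_diffQuot := (isChordalLipschitz_mode ℓ k).memLp_diffQuot (continuous_mode ℓ k).measurable

lemma norm_z_sub_mul_norm (x y : ℝ) :
    ‖z x - z y‖ * ‖((x : ℂ) + Complex.I) * (y + Complex.I)‖ = 2 * |x - y| := by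
  have hx := ofReal_add_I_ne_zero x
  have hy := ofReal_add_I_ne_zero y
  have hmul : (z x - z y) * ((x + Complex.I) * (y + Complex.I)) = (2 * (y - x) : ℝ) := by
    rw [← sub_sub_sub_cancel_right (z x) (z y) Complex.I, z_sub_I, z_sub_I]
    push_cast
    field_simp
    ring
  rw [← norm_mul, hmul, Complex.norm_real, Real.norm_eq_abs, abs_mul, abs_two, abs_sub_comm]

lemma exists_isChordalLipschitz {ψ : ℝ → ℝ} (hψ : ContDiff ℝ 1 ψ) (hc : HasCompactSupport ψ) :
    ∃ C, IsChordalLipschitz C ψ := by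
  have hψ' : ContDiff ℝ 1 fun x => (ψ x : ℂ) := Complex.ofRealCLM.contDiff.comp hψ
  have hc' : HasCompactSupport fun x => (ψ x : ℂ) := hc.comp_left Complex.ofReal_zero
  have hx : ContDiff ℝ 1 fun x : ℝ => (x : ℂ) + Complex.I :=
    Complex.ofRealCLM.contDiff.add contDiff_const
  set G : ℝ → ℂ := fun x => ψ x * (x + Complex.I) with hG
  set H : ℝ → ℂ := fun x => ψ x * (x + Complex.I) ^ 2 with hH
  obtain ⟨A, hA⟩ : ∃ A, ∀ x, ‖G x‖ ≤ A :=
    HasCompactSupport.exists_bound_of_continuous hc'.mul_right (hψ'.mul hx).continuous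
  obtain ⟨K, hK⟩ : ∃ K, LipschitzWith K H :=
    (hψ'.mul (hx.pow 2)).lipschitzWith_of_hasCompactSupport hc'.mul_right one_ne_zero
  refine ⟨(K + 2 * A) / 2, fun x y => ?_⟩
  have hident : ((ψ x - ψ y : ℝ) : ℂ) * ((x + Complex.I) * (y + Complex.I)) =
      H x - H y - (G x + G y) * (x - y : ℝ) := by
    simp only [hG, hH]
    push_cast
    ring
  have hbound : ‖H x - H y - (G x + G y) * (x - y : ℝ)‖ ≤ (K + 2 * A) * |x - y| := calc
    _ ≤ ‖H x - H y‖ + ‖G x + G y‖ * |x - y| := by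
      rw [← Real.norm_eq_abs, ← Complex.norm_real, ← norm_mul]; exact norm_sub_le _ _
    _ ≤ K * |x - y| + (A + A) * |x - y| := by
      gcongr
      · exact hK.norm_sub_le x y
      · exact (norm_add_le _ _).trans (add_le_add (hA x) (hA y))
    _ = (K + 2 * A) * |x - y| := by ring
  have hpos : 0 < ‖((x : ℂ) + Complex.I) * (y + Complex.I)‖ :=
    norm_pos_iff.mpr (mul_ne_zero (ofReal_add_I_ne_zero x) (ofReal_add_I_ne_zero y))
  refine le_of_mul_le_mul_right ?_ hpos
  rw [mul_assoc, norm_z_sub_mul_norm, ← Real.norm_eq_abs, ← Complex.norm_real, ← norm_mul, hident]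
  exact hbound.trans_eq (by ring)

lemma memHdotHalf_of_hasCompactSupport {ψ : ℝ → ℝ} (hψ : ContDiff ℝ 1 ψ)
    (hc : HasCompactSupport ψ) : MemHdotHalf ψ := by
  obtain ⟨C, hC⟩ := exists_isChordalLipschitz hψ hc
  obtain ⟨A, hA⟩ := hc.exists_bound_of_continuous hψ.continuous
  exact ⟨hψ.continuous.measurable,
    memLHalf_of_bounded hψ.continuous.aestronglyMeasurable hA,
    hC.memLp_diffQuot hψ.continuous.measurable⟩

/-! ### The weak form of the half-Laplacian -/

lemma MemLHalf.integrable_mul_of_hasCompactSupport {φ χ : ℝ → ℝ} (hφ : MemLHalf φ)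
    (hχ : Continuous χ) (hc : HasCompactSupport χ) : Integrable fun x => φ x * χ x := by
  obtain ⟨C, hC⟩ := (hc.mul_right (f' := fun x : ℝ => 1 + x ^ 2)).exists_bound_of_continuous
    (by fun_prop)
  refine hφ.mul hχ.aestronglyMeasurable (C := C) fun x => ?_
  simpa only [Pi.mul_apply, Real.norm_eq_abs, abs_mul,
    abs_of_pos (by positivity : 0 < 1 + x ^ 2)] using hC x

/-- The symmetric second difference of `ψ` at `x` with step `h`, the numerator of the integrand
of `absNabla`. -/
def secondDifference (ψ : ℝ → ℝ) (x h : ℝ) : ℝ := 2 * ψ x - ψ (x + h) - ψ (x - h)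

lemma secondDifference_neg (ψ : ℝ → ℝ) (x h : ℝ) :
    secondDifference ψ x (-h) = secondDifference ψ x h := by
  simp only [secondDifference, sub_neg_eq_add, ← sub_eq_add_neg]
  ring

lemma secondDifference_abs (ψ : ℝ → ℝ) (x h : ℝ) :
    secondDifference ψ x |h| = secondDifference ψ x h := by
  rcases abs_choice h with hh | hh <;> rw [hh]
  exact secondDifference_neg ψ x h

lemma absNabla_eq_integral (ψ : ℝ → ℝ) (x : ℝ) :
    absNabla ψ x = (2 * Real.pi)⁻¹ * ∫ h, secondDifference ψ x h / h ^ 2 := by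
  have heven := integral_comp_abs (f := fun h => secondDifference ψ x h / h ^ 2)
  simp only [secondDifference_abs, sq_abs] at heven
  rw [heven, absNabla]
  simp only [secondDifference]
  field_simp

lemma exists_abs_secondDifference_mul_le {ψ : ℝ → ℝ} (hψ : ContDiff ℝ (⊤ : ℕ∞) ψ)
    (hc : HasCompactSupport ψ) :
    ∃ D, ∀ x h, |secondDifference ψ x h| * (1 + x ^ 2) ≤ D * h ^ 2 := by
  set G : ℝ → ℝ := fun x => ψ x * x with hG
  set H : ℝ → ℝ := fun x => ψ x * (1 + x ^ 2) with hH
  obtain ⟨A, hA⟩ : ∃ A, ∀ x, |ψ x| ≤ A := hc.exists_bound_of_continuous hψ.continuous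
  obtain ⟨K, hK⟩ : ∃ K, LipschitzWith K G :=
    ContDiff.lipschitzWith_of_hasCompactSupport (hc.mul_right (f' := fun x => x))
      (hψ.mul contDiff_id) (by simp)
  obtain ⟨B, -, hB⟩ := second_difference_le (ψ := H) (hψ.mul (by fun_prop)) hc.mul_right
  have hB' (x h : ℝ) : |secondDifference H x h| ≤ B * h ^ 2 := by
    rw [← secondDifference_abs, ← sq_abs]
    exact hB x |h| (abs_nonneg h)
  refine ⟨B + 4 * K + 2 * A, fun x h => ?_⟩
  have hident : secondDifference ψ x h * (1 + x ^ 2) = secondDifference H x h +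
      2 * h * (G (x + h) - G (x - h)) - h ^ 2 * (ψ (x + h) + ψ (x - h)) := by
    simp only [secondDifference, hG, hH]
    ring
  have hGdiff : |2 * h * (G (x + h) - G (x - h))| ≤ 4 * K * h ^ 2 := by
    have h1 := hK.dist_le_mul (x + h) (x - h)
    rw [Real.dist_eq, Real.dist_eq, show x + h - (x - h) = 2 * h by ring] at h1
    calc |2 * h * (G (x + h) - G (x - h))| = |2 * h| * |G (x + h) - G (x - h)| := abs_mul _ _
      _ ≤ |2 * h| * (K * |2 * h|) := by gcongr
      _ = K * |2 * h| ^ 2 := by ring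
      _ = 4 * K * h ^ 2 := by rw [sq_abs]; ring
  have hψsum : |h ^ 2 * (ψ (x + h) + ψ (x - h))| ≤ 2 * A * h ^ 2 := by
    rw [abs_mul, abs_sq, mul_comm]
    gcongr
    exact (abs_add_le _ _).trans (by linarith [hA (x + h), hA (x - h)])
  calc |secondDifference ψ x h| * (1 + x ^ 2)
      = |secondDifference ψ x h * (1 + x ^ 2)| := by
        rw [abs_mul, abs_of_pos (by positivity : 0 < 1 + x ^ 2)]
    _ ≤ |secondDifference H x h| + |2 * h * (G (x + h) - G (x - h))| +
        |h ^ 2 * (ψ (x + h) + ψ (x - h))| := by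
        rw [hident]
        exact (abs_sub _ _).trans (by gcongr; exact abs_add_le _ _)
    _ ≤ B * h ^ 2 + 4 * K * h ^ 2 + 2 * A * h ^ 2 := by gcongr; exact hB' x h
    _ = (B + 4 * K + 2 * A) * h ^ 2 := by ring

lemma abs_shift_mul_le (ψ : ℝ → ℝ) (x h : ℝ) :
    |ψ (x + h)| * (1 + x ^ 2) ≤ 2 * (1 + h ^ 2) * |ψ (x + h) * (1 + (x + h) ^ 2)| := by
  have hpeetre : 1 + x ^ 2 ≤ 2 * (1 + h ^ 2) * (1 + (x + h) ^ 2) := by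
    nlinarith [sq_nonneg (x + 2 * h), sq_nonneg ((x + h) * h)]
  rw [abs_mul, abs_of_pos (by positivity : 0 < 1 + (x + h) ^ 2)]
  exact (mul_le_mul_of_nonneg_left hpeetre (abs_nonneg _)).trans_eq (by ring)

lemma abs_secondDifference_mul_le (ψ : ℝ → ℝ) (x h : ℝ) :
    |secondDifference ψ x h| * (1 + x ^ 2) ≤ 2 * |ψ x * (1 + x ^ 2)| + 2 * (1 + h ^ 2) *
      (|ψ (x + h) * (1 + (x + h) ^ 2)| + |ψ (x - h) * (1 + (x - h) ^ 2)|) := by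
  have htri : |secondDifference ψ x h| ≤ 2 * |ψ x| + |ψ (x + h)| + |ψ (x - h)| := by
    refine (abs_sub _ _).trans (add_le_add_left ((abs_sub _ _).trans_eq ?_) _)
    rw [abs_mul, abs_two]
  have hplus := abs_shift_mul_le ψ x h
  have hminus := abs_shift_mul_le ψ x (-h)
  rw [neg_sq, ← sub_eq_add_neg] at hminus
  have hzero : |ψ x * (1 + x ^ 2)| = |ψ x| * (1 + x ^ 2) := by
    rw [abs_mul, abs_of_pos (by positivity : 0 < 1 + x ^ 2)]
  calc _ ≤ (2 * |ψ x| + |ψ (x + h)| + |ψ (x - h)|) * (1 + x ^ 2) := by gcongr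
    _ ≤ _ := by rw [hzero]; linarith

lemma exists_abs_secondDifference_div_mul_le {ψ : ℝ → ℝ} (hψ : ContDiff ℝ (⊤ : ℕ∞) ψ)
    (hc : HasCompactSupport ψ) :
    ∃ D, ∀ x h, |secondDifference ψ x h / h ^ 2| * (1 + x ^ 2) ≤ D * (1 + h ^ 2)⁻¹ +
      2 * (|ψ (x + h) * (1 + (x + h) ^ 2)| + |ψ (x - h) * (1 + (x - h) ^ 2)|) := by
  obtain ⟨D, hD⟩ := exists_abs_secondDifference_mul_le hψ hc
  obtain ⟨A, hA⟩ := (hc.mul_right (f' := fun x : ℝ => 1 + x ^ 2)).exists_bound_of_continuous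
    (by fun_prop)
  have hD0 : 0 ≤ D := by
    simpa using (mul_nonneg (abs_nonneg _) (by positivity)).trans (hD 0 1)
  refine ⟨D + 2 * A, fun x h => ?_⟩
  set S := |ψ (x + h) * (1 + (x + h) ^ 2)| + |ψ (x - h) * (1 + (x - h) ^ 2)|
  set q := |secondDifference ψ x h / h ^ 2| * (1 + x ^ 2) with hq
  have hq_sq : q * h ^ 2 ≤ |secondDifference ψ x h| * (1 + x ^ 2) := by
    rw [hq, abs_div, abs_sq, mul_right_comm]
    gcongr
    rcases eq_or_ne (h ^ 2) 0 with h0 | h0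
    · rw [h0, mul_zero]
      exact abs_nonneg _
    · rw [div_mul_cancel₀ _ h0]
  have hq_le : q ≤ D := by
    rw [hq, abs_div, abs_sq, div_mul_eq_mul_div]
    exact div_le_of_le_mul₀ (sq_nonneg _) hD0 (hD x h)
  have hAx : |ψ x * (1 + x ^ 2)| ≤ A := hA x
  have hsum : q * (1 + h ^ 2) ≤ D + 2 * A + 2 * (1 + h ^ 2) * S := by
    linarith [abs_secondDifference_mul_le ψ x h]
  calc q = q * (1 + h ^ 2) * (1 + h ^ 2)⁻¹ := by field_simp
    _ ≤ (D + 2 * A + 2 * (1 + h ^ 2) * S) * (1 + h ^ 2)⁻¹ := by gcongr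
    _ = (D + 2 * A) * (1 + h ^ 2)⁻¹ + 2 * S := by field_simp

lemma integrable_mul_shift {u Ψ : ℝ → ℝ} (hu : Integrable u) (hΨ : Integrable Ψ) :
    Integrable (fun p : ℝ × ℝ => u p.1 * Ψ (p.1 + p.2)) ∧
      Integrable fun p : ℝ × ℝ => u p.1 * Ψ (p.1 - p.2) := by
  have hadd : Integrable fun p : ℝ × ℝ => u p.1 * Ψ (p.1 + p.2) :=
    (measurePreserving_prod_add volume volume).integrable_comp_of_integrable (hu.mul_prod hΨ)
  have hneg : MeasurePreserving (fun p : ℝ × ℝ => (p.1, -p.2)) (volume.prod volume)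
      (volume.prod volume) :=
    (MeasurePreserving.id volume).prod (Measure.measurePreserving_neg volume)
  exact ⟨hadd, by simpa only [sub_eq_add_neg] using! hneg.integrable_comp_of_integrable hadd⟩

lemma integrable_mul_secondDifference_div {φ ψ : ℝ → ℝ} (hφ : MemLHalf φ) (hm : Measurable φ)
    (hψ : ContDiff ℝ (⊤ : ℕ∞) ψ) (hc : HasCompactSupport ψ) :
    Integrable fun p : ℝ × ℝ => φ p.1 * (secondDifference ψ p.1 p.2 / p.2 ^ 2) := by
  have hψc := hψ.continuous
  obtain ⟨D, hD⟩ := exists_abs_secondDifference_div_mul_le hψ hc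
  have hΨ : Integrable fun x => |ψ x * (1 + x ^ 2)| :=
    ((by fun_prop : Continuous fun x => ψ x * (1 + x ^ 2)).integrable_of_hasCompactSupport
      hc.mul_right).abs
  have hu : Integrable fun x => |φ x / (1 + x ^ 2)| := Integrable.abs hφ
  obtain ⟨hplus, hminus⟩ := integrable_mul_shift hu hΨ
  have hmeas : Measurable fun p : ℝ × ℝ => secondDifference ψ p.1 p.2 / p.2 ^ 2 :=
    (by unfold secondDifference; fun_prop :
      Continuous fun p : ℝ × ℝ => secondDifference ψ p.1 p.2).measurable.div
        (measurable_snd.pow_const 2)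
  refine ((hu.mul_prod (integrable_inv_one_add_sq.const_mul D)).add
    ((hplus.add hminus).const_mul 2)).mono'
    ((hm.comp measurable_fst).mul hmeas).aestronglyMeasurable
    (Eventually.of_forall fun ⟨x, h⟩ => ?_)
  have hfactor : ‖φ x * (secondDifference ψ x h / h ^ 2)‖ =
      |φ x / (1 + x ^ 2)| * (|secondDifference ψ x h / h ^ 2| * (1 + x ^ 2)) := by
    have hpos : 0 < 1 + x ^ 2 := by positivity
    rw [norm_mul, Real.norm_eq_abs, Real.norm_eq_abs, abs_div (φ x), abs_of_pos hpos]
    field_simp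
  rw [hfactor]
  exact (mul_le_mul_of_nonneg_left (hD x h) (abs_nonneg _)).trans_eq
    (by simp only [Pi.add_apply]; ring)

lemma integral_mul_secondDifference {φ ψ : ℝ → ℝ} (hφ : MemLHalf φ) (hψ : Continuous ψ)
    (hc : HasCompactSupport ψ) (h : ℝ) :
    ∫ x, φ x * secondDifference ψ x h = ∫ x, (φ x - φ (x + h)) * (ψ x - ψ (x + h)) := by
  have hshift (c : ℝ) : Integrable fun x => φ x * (ψ x - ψ (x + c)) :=
    hφ.integrable_mul_of_hasCompactSupport (by fun_prop)
      (hc.sub (hc.comp_homeomorph (Homeomorph.addRight c)))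
  have hforward : Integrable fun x => φ (x + h) * (ψ (x + h) - ψ x) := by
    simpa using (hshift (-h)).comp_add_right h
  calc ∫ x, φ x * secondDifference ψ x h
      = ∫ x, (φ x * (ψ x - ψ (x + h)) + φ x * (ψ x - ψ (x + -h))) := by
        congr 1 with x
        simp only [secondDifference, sub_eq_add_neg x h]
        ring
    _ = (∫ x, φ x * (ψ x - ψ (x + h))) + ∫ x, φ x * (ψ x - ψ (x + -h)) :=
        integral_add (hshift h) (hshift (-h))
    _ = (∫ x, φ x * (ψ x - ψ (x + h))) + ∫ x, φ (x + h) * (ψ (x + h) - ψ x) := by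
        rw [← integral_add_right_eq_self (fun x => φ x * (ψ x - ψ (x + -h))) h]
        simp only [add_neg_cancel_right]
    _ = ∫ x, (φ x - φ (x + h)) * (ψ x - ψ (x + h)) := by
        rw [← integral_add (hshift h) hforward]
        congr 1 with x
        ring

lemma integral_mul_absNabla {φ ψ : ℝ → ℝ} (hφ : MemHdotHalf φ) (hψ : ContDiff ℝ (⊤ : ℕ∞) ψ)
    (hc : HasCompactSupport ψ) : ∫ x, φ x * absNabla ψ x = energy φ ψ := by
  have hψE : MemHdotHalf ψ := memHdotHalf_of_hasCompactSupport (hψ.of_le (by simp)) hc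
  have hshear := measurePreserving_prod_add (volume : Measure ℝ) volume
  have hquot : Integrable fun p => diffQuot φ p * diffQuot ψ p :=
    hφ.memLp_diffQuot.integrable_mul hψE.memLp_diffQuot
  have hstep (h : ℝ) : ∫ x, φ x * (secondDifference ψ x h / h ^ 2) =
      ∫ x, diffQuot φ (x, x + h) * diffQuot ψ (x, x + h) := by
    have hsq (x : ℝ) : diffQuot φ (x, x + h) * diffQuot ψ (x, x + h) =
        (φ x - φ (x + h)) * (ψ x - ψ (x + h)) / h ^ 2 := by
      rw [diffQuot, diffQuot, div_mul_div_comm, sub_add_cancel_left, neg_mul_neg, sq]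
    simp only [hsq, ← mul_div_assoc, integral_div,
      integral_mul_secondDifference hφ.memLHalf hψ.continuous hc]
  calc ∫ x, φ x * absNabla ψ x
      = (2 * Real.pi)⁻¹ * ∫ x, ∫ h, φ x * (secondDifference ψ x h / h ^ 2) := by
        simp only [absNabla_eq_integral, mul_left_comm (φ _), integral_const_mul]
    _ = (2 * Real.pi)⁻¹ * ∫ h, ∫ x, φ x * (secondDifference ψ x h / h ^ 2) := by
        rw [integral_integral_swap (f := fun x h => φ x * (secondDifference ψ x h / h ^ 2))
          (integrable_mul_secondDifference_div hφ.memLHalf hφ.measurable hψ hc)]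
    _ = (2 * Real.pi)⁻¹ * ∫ p : ℝ × ℝ,
          diffQuot φ (p.1, p.1 + p.2) * diffQuot ψ (p.1, p.1 + p.2) := by
        simp only [hstep]
        rw [Measure.volume_eq_prod]
        exact congrArg _
          (integral_prod_symm _ (hshear.integrable_comp_of_integrable hquot)).symm
    _ = energy φ ψ := by
        rw [energy, Measure.volume_eq_prod]
        exact congrArg _ (hshear.integral_comp
          (MeasurableEquiv.shearAddRight ℝ).measurableEmbedding
          fun p => diffQuot φ p * diffQuot ψ p)

/-! ### The half-Laplacian of the modes -/

lemma one_sub_le_norm_z_sub_mul (x y : ℝ) {r : ℝ} (hr : 0 ≤ r) : 1 - r ≤ ‖z x - r * z y‖ := by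
  have := norm_sub_norm_le (z x) (r * z y)
  rwa [norm_mul, norm_z, norm_z, Complex.norm_real, Real.norm_of_nonneg hr, mul_one] at this

lemma norm_z_sub_mul_pos (x y : ℝ) {r : ℝ} (hr : r ∈ Set.Ico 0 1) : 0 < ‖z x - r * z y‖ :=
  (sub_pos.mpr hr.2).trans_le (one_sub_le_norm_z_sub_mul x y hr.1)

lemma norm_z_sub_le_two_mul (x y : ℝ) {r : ℝ} (hr : r ∈ Set.Ico 0 1) :
    ‖z x - z y‖ ≤ 2 * ‖z x - r * z y‖ := by
  have hrest : ‖(1 - r : ℝ) * z y‖ = 1 - r := by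
    rw [norm_mul, norm_z, Complex.norm_real, Real.norm_of_nonneg (sub_nonneg.mpr hr.2.le), mul_one]
  calc ‖z x - z y‖ = ‖(z x - r * z y) - (1 - r : ℝ) * z y‖ := by push_cast; ring_nf
    _ ≤ ‖z x - r * z y‖ + (1 - r) := (norm_sub_le _ _).trans_eq (by rw [hrest])
    _ ≤ 2 * ‖z x - r * z y‖ := by linarith [one_sub_le_norm_z_sub_mul x y hr.1]

lemma norm_z_sub_mul_sq (x y r : ℝ) :
    (‖z x - r * z y‖ ^ 2 : ℂ) = (1 - r * (z x)⁻¹ * z y) * (1 - r * z x * (z y)⁻¹) := by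
  have hx := z_ne_zero x
  have hy := z_ne_zero y
  rw [← Complex.conj_mul', map_sub, map_mul, ← Complex.inv_eq_conj (norm_z x),
    ← Complex.inv_eq_conj (norm_z y), Complex.conj_ofReal]
  field_simp

/-- The kernel `1 / (x - y) ^ 2`, made bounded by moving the point `z y` to radius `r < 1`: it is
the Poisson kernel of the disc up to the factor `1 - r ^ 2`. -/
def regularizedKernel (r x y : ℝ) : ℝ := weight x * weight y / ‖z x - r * z y‖ ^ 2

lemma regularizedKernel_nonneg (r x y : ℝ) : 0 ≤ regularizedKernel r x y :=
  div_nonneg (mul_pos (weight_pos x) (weight_pos y)).le (sq_nonneg _)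

lemma regularizedKernel_comm (r x y : ℝ) : regularizedKernel r x y = regularizedKernel r y x := by
  have hsq : ‖z x - r * z y‖ ^ 2 = ‖z y - r * z x‖ ^ 2 := by
    apply Complex.ofReal_injective
    push_cast
    rw [norm_z_sub_mul_sq, norm_z_sub_mul_sq]
    ring
  rw [regularizedKernel, regularizedKernel, hsq, mul_comm (weight x)]

lemma regularizedKernel_one (x y : ℝ) :
    regularizedKernel 1 x y = ((x - y) ^ 2)⁻¹ := by
  have hw : weight x * weight y ≠ 0 := (mul_pos (weight_pos x) (weight_pos y)).ne'
  rw [regularizedKernel, Complex.ofReal_one, one_mul, norm_z_sub_sq, div_mul_cancel_right₀ hw]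

lemma regularizedKernel_le_four_mul {x y : ℝ} (hxy : x ≠ y) {r : ℝ} (hr : r ∈ Set.Ico 0 1) :
    regularizedKernel r x y ≤ 4 * regularizedKernel 1 x y := by
  have hw := mul_pos (weight_pos x) (weight_pos y)
  have hpos := norm_z_sub_mul_pos x y hr
  have hpos' : 0 < ‖z x - z y‖ := norm_sub_pos_iff.mpr (z_injective.ne hxy)
  have hsq : ‖z x - z y‖ ^ 2 ≤ 4 * ‖z x - r * z y‖ ^ 2 :=
    (pow_le_pow_left₀ hpos'.le (norm_z_sub_le_two_mul x y hr) 2).trans_eq (by ring)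
  rw [regularizedKernel, regularizedKernel, Complex.ofReal_one, one_mul, mul_div_assoc',
    div_le_div_iff₀ (by positivity) (by positivity)]
  nlinarith

lemma regularizedKernel_le (x y : ℝ) {r : ℝ} (hr : r ∈ Set.Ico 0 1) :
    regularizedKernel r x y ≤ weight x * weight y * ((1 - r) ^ 2)⁻¹ := by
  have hw := mul_pos (weight_pos x) (weight_pos y)
  have h1 := one_sub_le_norm_z_sub_mul x y hr.1
  have h2 := sub_pos.mpr hr.2
  rw [regularizedKernel, div_eq_mul_inv]
  gcongr

lemma measurable_regularizedKernel (r : ℝ) :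
    Measurable fun p : ℝ × ℝ => regularizedKernel r p.1 p.2 := by
  have hz := continuous_z.measurable
  have hw := continuous_weight.measurable
  unfold regularizedKernel
  fun_prop

lemma tendsto_regularizedKernel {x y : ℝ} (hxy : x ≠ y) :
    Tendsto (fun r => regularizedKernel r x y) (𝓝 1) (𝓝 (regularizedKernel 1 x y)) := by
  have hne : ‖z x - (1 : ℝ) * z y‖ ^ 2 ≠ 0 := by
    simpa [sub_eq_zero] using z_injective.ne hxy
  have hc : ContinuousAt (fun r : ℝ => ‖z x - r * z y‖ ^ 2) 1 := by fun_prop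
  exact tendsto_const_nhds.div hc hne

section Poisson

variable {c : ℂ}

lemma one_sub_norm_le_norm_one_sub_mul_zpow (c : ℂ) (e : ℤ) (y : ℝ) :
    1 - ‖c‖ ≤ ‖1 - c * z y ^ e‖ := by
  simpa only [norm_one, norm_mul, norm_z_zpow, mul_one] using
    norm_sub_norm_le (1 : ℂ) (c * z y ^ e)

lemma one_sub_mul_zpow_ne_zero (hc : ‖c‖ < 1) (e : ℤ) (y : ℝ) : 1 - c * z y ^ e ≠ 0 :=
  norm_pos_iff.mp ((sub_pos.mpr hc).trans_le (one_sub_norm_le_norm_one_sub_mul_zpow c e y))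

lemma integrable_weight_mul_zpow_mul_inv (hc : ‖c‖ < 1) (k e : ℤ) :
    Integrable fun y => weight y * z y ^ k * (1 - c * z y ^ e)⁻¹ := by
  refine (integrable_weight_mul_zpow k).mul_bdd (c := (1 - ‖c‖)⁻¹) ?_
    (Eventually.of_forall fun y => ?_)
  · exact ((continuous_const.sub (continuous_const.mul (continuous_z_zpow e))).inv₀
      (one_sub_mul_zpow_ne_zero hc e)).aestronglyMeasurable
  · rw [norm_inv]
    exact inv_anti₀ (sub_pos.mpr hc) (one_sub_norm_le_norm_one_sub_mul_zpow c e y)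

lemma hasSum_integral_weight_mul_zpow (hc : ‖c‖ < 1) (k e : ℤ) :
    HasSum (fun n : ℕ => c ^ n * ∫ y, (weight y : ℂ) * z y ^ (k + e * n))
      (∫ y, weight y * z y ^ k * (1 - c * z y ^ e)⁻¹) := by
  have hterm (n : ℕ) (y : ℝ) : weight y * z y ^ k * (c * z y ^ e) ^ n =
      c ^ n * (weight y * z y ^ (k + e * n)) := by
    rw [zpow_add₀ (z_ne_zero y), zpow_mul, zpow_natCast]
    ring
  have hint (n : ℕ) : Integrable fun y => weight y * z y ^ k * (c * z y ^ e) ^ n := by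
    simpa only [hterm] using (integrable_weight_mul_zpow _).const_mul (c ^ n)
  have hnorm (n : ℕ) (y : ℝ) :
      ‖weight y * z y ^ k * (c * z y ^ e) ^ n‖ = ‖c‖ ^ n * weight y := by
    rw [hterm, norm_mul, norm_mul, norm_z_zpow, norm_pow, Complex.norm_real,
      Real.norm_of_nonneg (weight_pos y).le, mul_one]
  have hsummable : Summable fun n : ℕ => ∫ y, ‖weight y * z y ^ k * (c * z y ^ e) ^ n‖ := by
    simp only [hnorm, integral_const_mul]
    exact (summable_geometric_of_lt_one (norm_nonneg c) hc).mul_right _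
  have hgeom (y : ℝ) : ∑' n : ℕ, weight y * z y ^ k * (c * z y ^ e) ^ n =
      weight y * z y ^ k * (1 - c * z y ^ e)⁻¹ := by
    rw [tsum_mul_left, tsum_geometric_of_norm_lt_one (by rwa [norm_mul, norm_z_zpow, mul_one])]
  have h := hasSum_integral_of_summable_integral_norm hint hsummable
  simp only [hgeom] at h
  simpa only [hterm, integral_const_mul] using h

lemma integral_weight_mul_pow_mul_inv_one_sub_mul (hc : ‖c‖ < 1) (k : ℕ) :
    ∫ y, weight y * z y ^ (k : ℤ) * (1 - c * z y ^ (1 : ℤ))⁻¹ =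
      if k = 0 then 2 * (Real.pi : ℂ) else 0 := by
  refine (hasSum_integral_weight_mul_zpow hc k 1).unique ?_
  convert hasSum_ite_eq 0 (if k = 0 then 2 * (Real.pi : ℂ) else 0) using 2 with n
  rw [integral_weight_mul_zpow]
  rcases n.eq_zero_or_pos with rfl | hn
  · simp
  · rw [if_neg (by omega), if_neg hn.ne', mul_zero]

lemma integral_weight_mul_pow_mul_inv_one_sub_mul_inv (hc : ‖c‖ < 1) (k : ℕ) :
    ∫ y, weight y * z y ^ (k : ℤ) * (1 - c * z y ^ (-1 : ℤ))⁻¹ = 2 * Real.pi * c ^ k := by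
  refine (hasSum_integral_weight_mul_zpow hc k (-1)).unique ?_
  convert hasSum_ite_eq k (2 * Real.pi * c ^ k) using 2 with n
  rw [integral_weight_mul_zpow]
  rcases eq_or_ne n k with rfl | hn
  · rw [if_pos (by omega), if_pos rfl, mul_comm]
  · rw [if_neg (by omega), if_neg hn, mul_zero]

end Poisson

lemma one_sub_sq_div_eq {A B : ℂ} {r : ℝ} (hAB : A * B = r ^ 2) (hA : 1 - A ≠ 0) (hB : 1 - B ≠ 0) :
    (1 - (r : ℂ) ^ 2) / ((1 - A) * (1 - B)) = (1 - A)⁻¹ + (1 - B)⁻¹ - 1 := by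
  field_simp
  linear_combination hAB

lemma integrable_regularizedKernel_mul_pow (x : ℝ) {r : ℝ} (hr : r ∈ Set.Ico 0 1) (k : ℕ) :
    Integrable fun y => (regularizedKernel r x y : ℂ) * z y ^ k := by
  have hm := (measurable_regularizedKernel r).comp
    (measurable_const (a := x) |>.prodMk measurable_id)
  refine Integrable.mono' (integrable_weight.const_mul (weight x) |>.mul_const ((1 - r) ^ 2)⁻¹)
    (hm.complex_ofReal.mul (continuous_z.pow k).measurable).aestronglyMeasurable
    (Eventually.of_forall fun y => ?_)
  rw [norm_mul, norm_pow, norm_z, one_pow, mul_one, Complex.norm_real,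
    Real.norm_of_nonneg (regularizedKernel_nonneg r x y)]
  exact regularizedKernel_le x y hr

lemma one_sub_sq_mul_integral_regularizedKernel_mul_pow (x : ℝ) {r : ℝ} (hr : r ∈ Set.Ico 0 1)
    (k : ℕ) : (1 - (r : ℂ) ^ 2) * ∫ y, (regularizedKernel r x y : ℂ) * z y ^ k =
      2 * Real.pi * (r ^ k * (weight x * z x ^ k)) := by
  have hnorm : ‖(r : ℂ)‖ < 1 := by rw [Complex.norm_real, Real.norm_of_nonneg hr.1]; exact hr.2
  have hA : ‖r * (z x)⁻¹‖ < 1 := by rwa [norm_mul, norm_inv, norm_z, inv_one, mul_one]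
  have hB : ‖r * z x‖ < 1 := by rwa [norm_mul, norm_z, mul_one]
  have hsplit (y : ℝ) : (1 - (r : ℂ) ^ 2) * ((regularizedKernel r x y : ℂ) * z y ^ k) =
      weight x * (weight y * z y ^ (k : ℤ) * (1 - r * (z x)⁻¹ * z y ^ (1 : ℤ))⁻¹ +
        weight y * z y ^ (k : ℤ) * (1 - r * z x * z y ^ (-1 : ℤ))⁻¹ -
        weight y * z y ^ (k : ℤ)) := by
    have hx := z_ne_zero x
    have hy := z_ne_zero y
    have hpartial := one_sub_sq_div_eq (r := r)
      (A := r * (z x)⁻¹ * z y ^ (1 : ℤ)) (B := r * z x * z y ^ (-1 : ℤ)) (by field_simp)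
      (one_sub_mul_zpow_ne_zero hA 1 y) (one_sub_mul_zpow_ne_zero hB (-1) y)
    rw [zpow_one, zpow_neg_one, ← norm_z_sub_mul_sq] at hpartial
    rw [regularizedKernel, zpow_one, zpow_neg_one, zpow_natCast]
    push_cast
    linear_combination (weight x * weight y * z y ^ k : ℂ) * hpartial
  have hiA := integrable_weight_mul_zpow_mul_inv hA k 1
  have hiB := integrable_weight_mul_zpow_mul_inv hB k (-1)
  rw [← integral_const_mul]
  simp only [hsplit]
  rw [integral_const_mul, integral_sub (by exact hiA.add hiB) (integrable_weight_mul_zpow k),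
    integral_add hiA hiB, integral_weight_mul_pow_mul_inv_one_sub_mul hA,
    integral_weight_mul_pow_mul_inv_one_sub_mul_inv hB, integral_weight_mul_zpow]
  simp only [Nat.cast_eq_zero]
  ring

lemma integral_regularizedKernel_mul_sub_pow (x : ℝ) {r : ℝ} (hr : r ∈ Set.Ico 0 1) (k : ℕ) :
    ∫ y, (regularizedKernel r x y : ℂ) * (z x ^ k - z y ^ k) =
      ((2 * Real.pi * ((∑ j ∈ Finset.range k, r ^ j) / (1 + r)) * weight x : ℝ) : ℂ) *
        z x ^ k := by
  have hr1 : 1 - (r : ℂ) ≠ 0 := by exact_mod_cast (sub_pos.mpr hr.2).ne'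
  have hr2 : 1 + (r : ℂ) ≠ 0 := by exact_mod_cast (add_pos_of_pos_of_nonneg one_pos hr.1).ne'
  have hgeom : (∑ j ∈ Finset.range k, (r : ℂ) ^ j) * (1 - r) = 1 - r ^ k := geom_sum_mul_neg _ k
  have h0 := one_sub_sq_mul_integral_regularizedKernel_mul_pow x hr 0
  have hk := one_sub_sq_mul_integral_regularizedKernel_mul_pow x hr k
  have hi0 := (integrable_regularizedKernel_mul_pow x hr 0).mul_const (z x ^ k)
  have hik := integrable_regularizedKernel_mul_pow x hr k
  simp only [pow_zero, mul_one, one_mul] at h0 hi0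
  simp only [mul_sub]
  rw [integral_sub hi0 hik, integral_mul_const]
  apply mul_left_cancel₀ (mul_ne_zero hr1 hr2)
  have hdiv := mul_div_cancel₀ (∑ j ∈ Finset.range k, (r : ℂ) ^ j) hr2
  push_cast
  linear_combination z x ^ k * h0 - hk -
    2 * Real.pi * weight x * z x ^ k * (hgeom + (1 - (r : ℂ)) * hdiv)

lemma integral_regularizedKernel_mul_mode_sub (ℓ : ℂ →L[ℝ] ℝ) (k : ℕ) (x : ℝ) {r : ℝ}
    (hr : r ∈ Set.Ico 0 1) :
    ∫ y, regularizedKernel r x y * (mode ℓ k x - mode ℓ k y) =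
      2 * Real.pi * ((∑ j ∈ Finset.range k, r ^ j) / (1 + r)) * weight x * mode ℓ k x := by
  have hint : Integrable fun y => (regularizedKernel r x y : ℂ) * (z x ^ k - z y ^ k) := by
    have hi0 := (integrable_regularizedKernel_mul_pow x hr 0).mul_const (z x ^ k)
    simp only [pow_zero, mul_one] at hi0
    simp only [mul_sub]
    exact hi0.sub (integrable_regularizedKernel_mul_pow x hr k)
  have h := ℓ.integral_comp_comm hint
  rw [integral_regularizedKernel_mul_sub_pow x hr] at h
  simpa only [mode, map_ofReal_mul, map_sub] using h

lemma integrable_regularizedKernel_mul_mul_sub {φ ψ : ℝ → ℝ} (hφ : MemLHalf φ)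
    (hm : Measurable ψ) {C : ℝ} (hC : ∀ x, |ψ x| ≤ C) {r : ℝ} (hr : r ∈ Set.Ico 0 1) :
    Integrable fun p : ℝ × ℝ => φ p.1 * (regularizedKernel r p.1 p.2 * (ψ p.1 - ψ p.2)) := by
  have hw := continuous_weight.measurable
  have hb : Measurable fun p : ℝ × ℝ =>
      (weight p.1 * weight p.2)⁻¹ * regularizedKernel r p.1 p.2 * (ψ p.1 - ψ p.2) := by
    have := measurable_regularizedKernel r
    fun_prop
  refine ((hφ.integrable_weight_mul.mul_prod integrable_weight).mul_bdd
    (c := ((1 - r) ^ 2)⁻¹ * (C + C)) hb.aestronglyMeasurable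
    (Eventually.of_forall fun p => ?_)).congr (Eventually.of_forall fun p => ?_)
  · have hpos := mul_pos (weight_pos p.1) (weight_pos p.2)
    have hk := regularizedKernel_nonneg r p.1 p.2
    rw [norm_mul, Real.norm_of_nonneg (by positivity)]
    refine mul_le_mul ?_ ((abs_sub _ _).trans (add_le_add (hC _) (hC _))) (abs_nonneg _)
      (by positivity)
    rw [inv_mul_le_iff₀ hpos]
    exact regularizedKernel_le p.1 p.2 hr
  · have h1 := (weight_pos p.1).ne'
    have h2 := (weight_pos p.2).ne'
    field_simp

lemma integral_regularizedKernel_mul_sub_mul_mode_sub (ℓ : ℂ →L[ℝ] ℝ) (k : ℕ) {φ : ℝ → ℝ}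
    (hφ : MemLHalf φ) {r : ℝ} (hr : r ∈ Set.Ico 0 1) :
    ∫ p : ℝ × ℝ, regularizedKernel r p.1 p.2 *
        ((φ p.1 - φ p.2) * (mode ℓ k p.1 - mode ℓ k p.2)) =
      4 * Real.pi * ((∑ j ∈ Finset.range k, r ^ j) / (1 + r)) *
        ∫ x, weight x * φ x * mode ℓ k x := by
  set G : ℝ × ℝ → ℝ := fun p =>
    φ p.1 * (regularizedKernel r p.1 p.2 * (mode ℓ k p.1 - mode ℓ k p.2)) with hG
  have hGi : Integrable G (volume.prod volume) := integrable_regularizedKernel_mul_mul_sub hφ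
    (continuous_mode ℓ k).measurable (abs_mode_le ℓ k) hr
  have hvalue : ∫ p, G p = 2 * Real.pi * ((∑ j ∈ Finset.range k, r ^ j) / (1 + r)) *
      ∫ x, weight x * φ x * mode ℓ k x := by
    rw [Measure.volume_eq_prod, integral_prod _ hGi, ← integral_const_mul]
    congr 1; funext x
    simp only [hG]
    rw [integral_const_mul, integral_regularizedKernel_mul_mode_sub ℓ k x hr]
    ring
  have hswap : ∫ p : ℝ × ℝ, G p.swap = ∫ p, G p := by
    rw [Measure.volume_eq_prod]
    exact integral_prod_swap G
  calc _ = ∫ p : ℝ × ℝ, (G p + G p.swap) := by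
        congr 1; funext p
        simp only [hG, Prod.fst_swap, Prod.snd_swap, regularizedKernel_comm r p.2 p.1]
        ring
    _ = (∫ p, G p) + ∫ p : ℝ × ℝ, G p.swap := integral_add hGi hGi.swap
    _ = _ := by rw [hswap, hvalue]; ring

lemma diffQuot_mul_diffQuot (φ ψ : ℝ → ℝ) (p : ℝ × ℝ) : diffQuot φ p * diffQuot ψ p =
    regularizedKernel 1 p.1 p.2 * ((φ p.1 - φ p.2) * (ψ p.1 - ψ p.2)) := by
  rw [regularizedKernel_one, diffQuot, diffQuot, div_mul_div_comm, ← sq, div_eq_inv_mul]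

lemma tendsto_integral_regularizedKernel {φ ψ : ℝ → ℝ} (hφ : MemHdotHalf φ) (hψ : MemHdotHalf ψ) :
    Tendsto (fun r => ∫ p : ℝ × ℝ, regularizedKernel r p.1 p.2 *
        ((φ p.1 - φ p.2) * (ψ p.1 - ψ p.2))) (𝓝[<] 1)
      (𝓝 (∫ p, diffQuot φ p * diffQuot ψ p)) := by
  refine tendsto_integral_filter_of_dominated_convergence
    (fun p => 4 * ‖diffQuot φ p * diffQuot ψ p‖) (Eventually.of_forall fun r => ?_) ?_
    ((hφ.memLp_diffQuot.integrable_mul hψ.memLp_diffQuot).norm.const_mul 4)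
    (Eventually.of_forall fun p => ?_)
  · have h1 := hφ.measurable
    have h2 := hψ.measurable
    have h3 := measurable_regularizedKernel r
    exact Measurable.aestronglyMeasurable (by fun_prop)
  · filter_upwards [Ico_mem_nhdsLT (zero_lt_one' ℝ)] with r hr
    refine Eventually.of_forall fun p => ?_
    rcases eq_or_ne p.1 p.2 with e | e
    · simp [diffQuot, e]
    · rw [diffQuot_mul_diffQuot, norm_mul (regularizedKernel r _ _),
        norm_mul (regularizedKernel 1 _ _), ← mul_assoc,
        Real.norm_of_nonneg (regularizedKernel_nonneg _ _ _),
        Real.norm_of_nonneg (regularizedKernel_nonneg _ _ _)]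
      exact mul_le_mul_of_nonneg_right (regularizedKernel_le_four_mul e hr) (norm_nonneg _)
  · rcases eq_or_ne p.1 p.2 with e | e
    · simp [diffQuot, e]
    · rw [diffQuot_mul_diffQuot]
      exact ((tendsto_regularizedKernel e).mono_left nhdsWithin_le_nhds).mul_const _

lemma energy_mode (ℓ : ℂ →L[ℝ] ℝ) (k : ℕ) {φ : ℝ → ℝ} (hφ : MemHdotHalf φ) :
    energy φ (mode ℓ k) = k * ∫ x, weight x * φ x * mode ℓ k x := by
  set I := ∫ x, weight x * φ x * mode ℓ k x
  have hc : ContinuousAt (fun r : ℝ =>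
      4 * Real.pi * ((∑ j ∈ Finset.range k, r ^ j) / (1 + r)) * I) 1 := by
    have hsum : ContinuousAt (fun r : ℝ => ∑ j ∈ Finset.range k, r ^ j) 1 := by fun_prop
    exact (continuousAt_const.mul (hsum.div (by fun_prop) (by norm_num))).mul continuousAt_const
  have hlim := hc.tendsto.mono_left (nhdsWithin_le_nhds (s := Set.Iio 1))
  have hvalue := tendsto_nhds_unique
    (tendsto_integral_regularizedKernel hφ (memHdotHalf_mode ℓ k)) (hlim.congr' ?_)
  · rw [energy, hvalue]
    simp only [one_pow, Finset.sum_const, Finset.card_range, nsmul_eq_mul, mul_one]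
    field_simp
    ring
  · filter_upwards [Ico_mem_nhdsLT (zero_lt_one' ℝ)] with r hr
    exact (integral_regularizedKernel_mul_sub_mul_mode_sub ℓ k hφ.memLHalf hr).symm

/-! ### Testing the equations against the modes -/

lemma contDiff_mode (ℓ : ℂ →L[ℝ] ℝ) (k : ℕ) : ContDiff ℝ (⊤ : ℕ∞) (mode ℓ k) := by
  have hx : ContDiff ℝ (⊤ : ℕ∞) fun x : ℝ => (x : ℂ) := Complex.ofRealCLM.contDiff
  have hz : ContDiff ℝ (⊤ : ℕ∞) z := by
    unfold z
    simp only [div_eq_mul_inv]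
    exact contDiff_const.mul ((hx.sub contDiff_const).mul
      ((hx.add contDiff_const).inv ofReal_add_I_ne_zero))
  exact ℓ.contDiff.comp (hz.pow k)

/-- A sequence of test functions that are uniformly Lipschitz for the chordal distance and converge
pointwise to `u`; this is enough to pass to the limit in the weak form of an equation. -/
structure IsTestApproximation (C : ℝ) (ψ : ℕ → ℝ → ℝ) (u : ℝ → ℝ) : Prop where
  contDiff (n : ℕ) : ContDiff ℝ (⊤ : ℕ∞) (ψ n)
  hasCompactSupport (n : ℕ) : HasCompactSupport (ψ n)
  isChordalLipschitz (n : ℕ) : IsChordalLipschitz C (ψ n)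
  tendsto (x : ℝ) : Tendsto (fun n => ψ n x) atTop (𝓝 (u x))

lemma exists_smooth_threshold : ∃ (τ : ℝ → ℝ) (K A : ℝ), ContDiff ℝ (⊤ : ℕ∞) τ ∧
    (∀ s, |s| ≤ 1 → τ s = 0) ∧ (∀ s t, |τ s - τ t| ≤ K * |s - t|) ∧ ∀ s, |τ s - s| ≤ A := by
  let b : ContDiffBump (0 : ℝ) := ⟨1, 2, by norm_num, by norm_num⟩
  have hsupp : HasCompactSupport fun s : ℝ => s * b s := b.hasCompactSupport.mul_left
  have hsmooth : ContDiff ℝ (⊤ : ℕ∞) fun s : ℝ => s * b s := contDiff_id.mul b.contDiff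
  obtain ⟨K, hK⟩ := hsmooth.lipschitzWith_of_hasCompactSupport hsupp (by simp)
  obtain ⟨A, hA⟩ := hsupp.exists_bound_of_continuous hsmooth.continuous
  refine ⟨fun s => s - s * b s, 1 + K, A, contDiff_id.sub hsmooth, fun s hs => ?_, fun s t => ?_,
    fun s => ?_⟩
  · have hone : b s = 1 := b.one_of_mem_closedBall (by simpa [b] using hs)
    simp only [hone, mul_one, sub_self]
  · rw [sub_sub_sub_comm, add_mul, one_mul]
    exact (abs_sub _ _).trans (add_le_add_right (hK.dist_le_mul s t) _)
  · rw [sub_sub_cancel_left, abs_neg]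
    exact hA s

lemma exists_isTestApproximation {u : ℝ → ℝ} {C : ℝ} (hu : ContDiff ℝ (⊤ : ℕ∞) u)
    (hC : IsChordalLipschitz C u) (h0 : Tendsto u (cocompact ℝ) (𝓝 0)) :
    ∃ C' ψ, IsTestApproximation C' ψ u := by
  obtain ⟨τ, K, A, hτ, hτ0, hτK, hτA⟩ := exists_smooth_threshold
  have hN (n : ℕ) : (0 : ℝ) < n + 1 := by positivity
  have hK0 : 0 ≤ K := by simpa using (abs_nonneg _).trans (hτK 1 0)
  refine ⟨K * C, fun n x => ((n : ℝ) + 1)⁻¹ * τ ((n + 1) * u x),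
    fun n => contDiff_const.mul (hτ.comp (contDiff_const.mul hu)), fun n => ?_, fun n x y => ?_,
    fun x => ?_⟩
  · rw [hasCompactSupport_iff_eventuallyEq, coclosedCompact_eq_cocompact]
    have hn : Tendsto (fun x => ((n : ℝ) + 1) * u x) (cocompact ℝ) (𝓝 0) := by
      simpa only [mul_zero] using h0.const_mul ((n : ℝ) + 1)
    filter_upwards [hn (Metric.closedBall_mem_nhds 0 one_pos)] with x hx
    rw [Set.mem_preimage, mem_closedBall_zero_iff, Real.norm_eq_abs] at hx
    simp only [hτ0 _ hx, mul_zero, Pi.zero_apply]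
  · rw [← mul_sub, abs_mul, abs_of_pos (inv_pos.mpr (hN n)), inv_mul_le_iff₀ (hN n)]
    calc |τ ((n + 1) * u x) - τ ((n + 1) * u y)|
        ≤ K * |(n + 1) * u x - (n + 1) * u y| := hτK _ _
      _ = (n + 1) * (K * |u x - u y|) := by rw [← mul_sub, abs_mul, abs_of_pos (hN n)]; ring
      _ ≤ (n + 1) * (K * (C * ‖z x - z y‖)) := by gcongr; exact hC x y
      _ = (n + 1) * (K * C * ‖z x - z y‖) := by rw [mul_assoc K]
  · have hrate : Tendsto (fun n : ℕ => A * ((n : ℝ) + 1)⁻¹) atTop (𝓝 0) := by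
      simpa using (tendsto_one_div_add_atTop_nhds_zero_nat (𝕜 := ℝ)).const_mul A
    refine tendsto_iff_norm_sub_tendsto_zero.mpr (squeeze_zero (fun n => norm_nonneg _)
      (fun n => ?_) hrate)
    have hdiff : ((n : ℝ) + 1)⁻¹ * τ ((n + 1) * u x) - u x =
        (τ ((n + 1) * u x) - (n + 1) * u x) * ((n : ℝ) + 1)⁻¹ := by
      have := (hN n).ne'
      field_simp
    rw [hdiff, norm_mul, norm_inv, Real.norm_of_nonneg (hN n).le]
    exact mul_le_mul_of_nonneg_right (hτA _) (inv_pos.mpr (hN n)).le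

namespace IsTestApproximation

variable {C : ℝ} {ψ : ℕ → ℝ → ℝ} {u : ℝ → ℝ}

lemma abs_le (h : IsTestApproximation C ψ u) (n : ℕ) (x : ℝ) : |ψ n x| ≤ 2 * C :=
  (h.isChordalLipschitz n).abs_le_of_tendsto_zero
    ((h.hasCompactSupport n).is_zero_at_infty) x

lemma tendsto_integral_mul (h : IsTestApproximation C ψ u) {v : ℝ → ℝ} (hv : Integrable v) :
    Tendsto (fun n => ∫ x, v x * ψ n x) atTop (𝓝 (∫ x, v x * u x)) := by
  refine tendsto_integral_of_dominated_convergence (fun x => ‖v x‖ * (2 * C))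
    (fun n => hv.aestronglyMeasurable.mul (h.contDiff n).continuous.aestronglyMeasurable)
    (hv.norm.mul_const _) (fun n => Eventually.of_forall fun x => ?_)
    (Eventually.of_forall fun x => (h.tendsto x).const_mul _)
  rw [norm_mul]
  exact mul_le_mul_of_nonneg_left (h.abs_le n x) (norm_nonneg _)

lemma tendsto_energy (h : IsTestApproximation C ψ u) {φ : ℝ → ℝ} (hφ : MemHdotHalf φ) :
    Tendsto (fun n => energy φ (ψ n)) atTop (𝓝 (energy φ u)) := by
  refine Tendsto.const_mul _ (tendsto_integral_of_dominated_convergence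
    (fun p => ‖diffQuot φ p‖ * (C * √(weight p.1 * weight p.2))) (fun n => ?_)
    (hφ.memLp_diffQuot.norm.integrable_mul (memLp_sqrt_weight_mul_weight.const_mul C))
    (fun n => Eventually.of_forall fun p => ?_) (Eventually.of_forall fun p =>
      ((((h.tendsto p.1).sub (h.tendsto p.2)).div_const _).const_mul _)))
  · exact ((measurable_diffQuot hφ.measurable).mul
      (measurable_diffQuot (h.contDiff n).continuous.measurable)).aestronglyMeasurable
  · rw [norm_mul]
    exact mul_le_mul_of_nonneg_left ((h.isChordalLipschitz n).abs_diffQuot_le p) (norm_nonneg _)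

end IsTestApproximation

lemma energy_eq_integral_mul {φ v u : ℝ → ℝ} {C : ℝ} (hφ : MemHdotHalf φ) (hv : Integrable v)
    (h : ∀ ψ : ℝ → ℝ, ContDiff ℝ (⊤ : ℕ∞) ψ → HasCompactSupport ψ → energy φ ψ = ∫ x, v x * ψ x)
    (hu : ContDiff ℝ (⊤ : ℕ∞) u) (hC : IsChordalLipschitz C u)
    (h0 : Tendsto u (cocompact ℝ) (𝓝 0)) : energy φ u = ∫ x, v x * u x := by
  obtain ⟨C', ψ, hψ⟩ := exists_isTestApproximation hu hC h0
  refine tendsto_nhds_unique (hψ.tendsto_energy hφ) ?_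
  simpa only [h _ (hψ.contDiff _) (hψ.hasCompactSupport _)] using hψ.tendsto_integral_mul hv

-- The constants `1 = z ^ 0` are not test functions, not even in the limit: `ℓ (z ^ k)` has to be
-- corrected by its value at infinity.
lemma mul_integral_weight_mul_mode_eq {φ v : ℝ → ℝ} (hφ : MemHdotHalf φ) (hv : Integrable v)
    (h : ∀ ψ : ℝ → ℝ, ContDiff ℝ (⊤ : ℕ∞) ψ → HasCompactSupport ψ → energy φ ψ = ∫ x, v x * ψ x)
    (ℓ : ℂ →L[ℝ] ℝ) (k : ℕ) : k * ∫ x, weight x * φ x * mode ℓ k x =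
      (∫ x, v x * mode ℓ k x) - ℓ (Complex.I ^ k) * ∫ x, v x := by
  set c := ℓ (Complex.I ^ k)
  have h0 : Tendsto (fun x => mode ℓ k x - c) (cocompact ℝ) (𝓝 0) :=
    tendsto_sub_nhds_zero_iff.mpr (tendsto_mode_cocompact ℓ k)
  have htest := energy_eq_integral_mul hφ hv h ((contDiff_mode ℓ k).sub contDiff_const)
    ((isChordalLipschitz_mode ℓ k).sub_const c) h0
  rw [energy_sub_const, energy_mode ℓ k hφ] at htest
  simp only [mul_sub] at htest
  rw [htest, integral_sub (integrable_mul_mode hv ℓ k) (hv.mul_const c), integral_mul_const,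
    mul_comm c]

lemma Lplus_eq (m : ℕ) {φ ψ : ℝ → ℝ} (hφ : MemHdotHalf φ) (hψ : ContDiff ℝ (⊤ : ℕ∞) ψ)
    (hc : HasCompactSupport ψ) :
    Lplus m φ ψ = energy φ ψ - ∫ x, m * (weight x * φ x) * ψ x := by
  simp only [Lplus, integral_mul_absNabla hφ hψ hc, norm_deriv_Q, mul_assoc]

lemma kernel_le_weight_mul_weight (m : ℕ) (x y : ℝ) :
    kernel m x y ≤ m ^ 2 * (weight x * weight y) := by
  have hpos := mul_pos (weight_pos x) (weight_pos y)
  rw [kernel, norm_Q_sub, sq_abs]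
  refine div_le_of_le_mul₀ (sq_nonneg _) (by positivity) ?_
  calc ‖z x ^ m - z y ^ m‖ ^ 2 ≤ (m * ‖z x - z y‖) ^ 2 :=
        pow_le_pow_left₀ (norm_nonneg _) (norm_pow_sub_le (norm_z x) (norm_z y) m) 2
    _ = m ^ 2 * (weight x * weight y) * (x - y) ^ 2 := by rw [mul_pow, norm_z_sub_sq]; ring

lemma integrable_kernel_mul (m : ℕ) {φ : ℝ → ℝ} (hφ : MemLHalf φ) (hm : Measurable φ) :
    Integrable fun p : ℝ × ℝ => kernel m p.1 p.2 * φ p.2 := by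
  refine ((integrable_weight.mul_prod hφ.integrable_weight_mul.norm).const_mul
    ((m : ℝ) ^ 2)).mono' ((measurable_kernel m).mul (hm.comp measurable_snd)).aestronglyMeasurable
    (Eventually.of_forall fun p => ?_)
  rw [norm_mul, norm_mul, Real.norm_of_nonneg (kernel_nonneg m _ _),
    Real.norm_of_nonneg (weight_pos p.2).le, ← mul_assoc, ← mul_assoc, mul_assoc (_ ^ 2)]
  exact mul_le_mul_of_nonneg_right (kernel_le_weight_mul_weight m _ _) (norm_nonneg _)

lemma integrable_R (m : ℕ) {φ : ℝ → ℝ} (hφ : MemLHalf φ) (hm : Measurable φ) :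
    Integrable (R m φ) :=
  (integrable_kernel_mul m hφ hm).integral_prod_left.const_mul _

lemma integral_R_mul (m : ℕ) {φ u : ℝ → ℝ} (hφ : MemLHalf φ) (hm : Measurable φ)
    (hu : Measurable u) {C : ℝ} (hC : ∀ x, |u x| ≤ C) :
    ∫ x, R m φ x * u x = ∫ x, φ x * R m u x := by
  have hint : Integrable (fun p : ℝ × ℝ => kernel m p.1 p.2 * φ p.2 * u p.1)
      (volume.prod volume) :=
    (integrable_kernel_mul m hφ hm).mul_bdd (hu.comp measurable_fst).aestronglyMeasurable
      (Eventually.of_forall fun p => hC p.1)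
  calc ∫ x, R m φ x * u x
      = ∫ x, (2 * Real.pi)⁻¹ * ∫ y, kernel m x y * φ y * u x := by
        simp only [integral_mul_const, R, mul_assoc (2 * Real.pi)⁻¹]
    _ = ∫ y, (2 * Real.pi)⁻¹ * ∫ x, kernel m x y * φ y * u x := by
        rw [integral_const_mul, integral_integral_swap hint, integral_const_mul]
    _ = ∫ y, φ y * R m u y := by
        congr 1; funext y
        simp only [R, mul_left_comm (φ y), ← integral_const_mul, kernel_comm m y, mul_assoc]

lemma integral_R_mul_mode (m : ℕ) (ℓ : ℂ →L[ℝ] ℝ) (k : ℕ) {φ : ℝ → ℝ} (hφ : MemLHalf φ)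
    (hm : Measurable φ) :
    ∫ x, R m φ x * mode ℓ k x = (m - k : ℕ) * ∫ x, weight x * φ x * mode ℓ k x := by
  rw [integral_R_mul m hφ hm (continuous_mode ℓ k).measurable (abs_mode_le ℓ k),
    ← integral_const_mul]
  congr 1; funext x
  rw [R_mode]
  ring

lemma mode_re_zero (x : ℝ) : mode Complex.reCLM 0 x = 1 := by simp [mode]

lemma integral_R (m : ℕ) {φ : ℝ → ℝ} (hφ : MemLHalf φ) (hm : Measurable φ) :
    ∫ x, R m φ x = m * ∫ x, weight x * φ x := by
  simpa only [mode_re_zero, mul_one, Nat.sub_zero] using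
    integral_R_mul_mode m Complex.reCLM 0 hφ hm

lemma Lminus_eq (m : ℕ) {φ ψ : ℝ → ℝ} (hφ : MemHdotHalf φ) (hψ : ContDiff ℝ (⊤ : ℕ∞) ψ)
    (hc : HasCompactSupport ψ) :
    Lminus m φ ψ = energy φ ψ - ∫ x, (m * (weight x * φ x) - R m φ x) * ψ x := by
  obtain ⟨C, hC⟩ := hc.exists_bound_of_continuous hψ.continuous
  have hbdd {v : ℝ → ℝ} (hv : Integrable v) : Integrable fun x => v x * ψ x :=
    hv.mul_bdd hψ.continuous.aestronglyMeasurable (Eventually.of_forall hC)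
  have hpot := hbdd (hφ.memLHalf.integrable_weight_mul.const_mul (m : ℝ))
  have hR := hbdd (integrable_R m hφ.memLHalf hφ.measurable)
  simp only [sub_mul]
  rw [Lminus, Lplus_eq m hφ hψ hc, integral_sub hpot hR]
  ring

lemma sub_mul_integral_weight_mul_mode_of_Lplus (m : ℕ) {φ : ℝ → ℝ} (hφ : MemHdotHalf φ)
    (h : ∀ ψ : ℝ → ℝ, ContDiff ℝ (⊤ : ℕ∞) ψ → HasCompactSupport ψ → Lplus m φ ψ = 0)
    (ℓ : ℂ →L[ℝ] ℝ) (k : ℕ) : ((m : ℝ) - k) * ∫ x, weight x * φ x * mode ℓ k x =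
      m * (ℓ (Complex.I ^ k) * ∫ x, weight x * φ x) := by
  have hcoeff := mul_integral_weight_mul_mode_eq hφ
    (hφ.memLHalf.integrable_weight_mul.const_mul (m : ℝ))
    (fun ψ hψ hc => sub_eq_zero.mp ((Lplus_eq m hφ hψ hc).symm.trans (h ψ hψ hc))) ℓ k
  simp only [mul_assoc (m : ℝ), integral_const_mul] at hcoeff
  linarith

lemma sub_mul_integral_weight_mul_mode_of_Lminus (m : ℕ) {φ : ℝ → ℝ} (hφ : MemHdotHalf φ)
    (h : ∀ ψ : ℝ → ℝ, ContDiff ℝ (⊤ : ℕ∞) ψ → HasCompactSupport ψ → Lminus m φ ψ = 0)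
    (ℓ : ℂ →L[ℝ] ℝ) (k : ℕ) :
    ((m : ℝ) - k - (m - k : ℕ)) * ∫ x, weight x * φ x * mode ℓ k x = 0 := by
  have hpot := hφ.memLHalf.integrable_weight_mul.const_mul (m : ℝ)
  have hR := integrable_R m hφ.memLHalf hφ.measurable
  have hcoeff := mul_integral_weight_mul_mode_eq hφ (hpot.sub hR)
    (fun ψ hψ hc => sub_eq_zero.mp ((Lminus_eq m hφ hψ hc).symm.trans (h ψ hψ hc))) ℓ k
  simp only [Pi.sub_apply, sub_mul] at hcoeff
  rw [integral_sub (integrable_mul_mode hpot ℓ k) (integrable_mul_mode hR ℓ k),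
    integral_sub hpot hR, integral_R_mul_mode m ℓ k hφ.memLHalf hφ.measurable,
    integral_R m hφ.memLHalf hφ.measurable] at hcoeff
  simp only [mul_assoc (m : ℝ), integral_const_mul, sub_self, mul_zero] at hcoeff
  linarith

lemma Lplus_mode (m : ℕ) (ℓ : ℂ →L[ℝ] ℝ) (k : ℕ) {ψ : ℝ → ℝ} (hψ : ContDiff ℝ (⊤ : ℕ∞) ψ)
    (hc : HasCompactSupport ψ) :
    Lplus m (mode ℓ k) ψ = ((k : ℝ) - m) * ∫ x, weight x * mode ℓ k x * ψ x := by
  have hψ' := memHdotHalf_of_hasCompactSupport (hψ.of_le (by simp)) hc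
  rw [Lplus_eq m (memHdotHalf_mode ℓ k) hψ hc, energy_comm, energy_mode ℓ k hψ']
  simp only [mul_assoc (m : ℝ), integral_const_mul, mul_right_comm (weight _) (ψ _)]
  ring

lemma Lminus_mode (m : ℕ) (ℓ : ℂ →L[ℝ] ℝ) (k : ℕ) {ψ : ℝ → ℝ} (hψ : ContDiff ℝ (⊤ : ℕ∞) ψ)
    (hc : HasCompactSupport ψ) : Lminus m (mode ℓ k) ψ =
      ((k : ℝ) - m + (m - k : ℕ)) * ∫ x, weight x * mode ℓ k x * ψ x := by
  rw [Lminus, Lplus_mode m ℓ k hψ hc, add_mul]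
  simp only [R_mode, mul_assoc, integral_const_mul]

/-! ### The trigonometric system -/

section Completeness

open scoped BoundedContinuousFunction

lemma integral_withDensity_ofReal {X : Type*} [MeasurableSpace X] {μ : Measure X} {v : X → ℝ}
    (hv : AEMeasurable v μ) (q : X → ℂ) :
    ∫ x, q x ∂μ.withDensity (fun x => ENNReal.ofReal (v x)) = ∫ x, (max (v x) 0 : ℝ) * q x ∂μ := by
  rw [integral_withDensity_eq_integral_toReal_smul₀ hv.ennreal_ofReal (by simp)]
  simp only [ENNReal.toReal_ofReal', Complex.real_smul]

lemma integrable_ofReal_mul {X : Type*} [MeasurableSpace X] [TopologicalSpace X] [BorelSpace X]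
    {μ : Measure X} {v : X → ℝ} (hv : Integrable v μ) (q : X →ᵇ ℂ) :
    Integrable (fun x => (v x : ℂ) * q x) μ :=
  hv.ofReal.mul_bdd q.continuous.measurable.aestronglyMeasurable
    (Eventually.of_forall q.norm_coe_le_norm)

-- The positive and the negative part of `v` are the densities of two finite measures which agree
-- on `A`, and a separating algebra determines a finite measure.
lemma ae_eq_zero_of_forall_mem_integral_mul_eq_zero {X : Type*} [MeasurableSpace X]
    [PseudoEMetricSpace X] [BorelSpace X] [CompleteSpace X] [SecondCountableTopology X]
    {μ : Measure X} {v : X → ℝ} (hv : Integrable v μ) {A : StarSubalgebra ℂ (X →ᵇ ℂ)}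
    (hA : (A.map (BoundedContinuousFunction.toContinuousMapStarₐ ℂ)).SeparatesPoints)
    (h : ∀ q ∈ A, ∫ x, (v x : ℂ) * q x ∂μ = 0) : v =ᵐ[μ] 0 := by
  have hpos : IsFiniteMeasure (μ.withDensity fun x => ENNReal.ofReal (v x)) :=
    isFiniteMeasure_withDensity_ofReal hv.2
  have hneg : IsFiniteMeasure (μ.withDensity fun x => ENNReal.ofReal (-v x)) :=
    isFiniteMeasure_withDensity_ofReal hv.neg.2
  have hm := hv.1.aemeasurable
  have hmeasure : μ.withDensity (fun x => ENNReal.ofReal (v x)) =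
      μ.withDensity fun x => ENNReal.ofReal (-v x) := by
    refine ext_of_forall_mem_subalgebra_integral_eq_of_pseudoEMetric_complete_countable hA
      fun q hq => ?_
    rw [integral_withDensity_ofReal hm,
      integral_withDensity_ofReal (v := fun x => -v x) hm.neg, ← sub_eq_zero,
      ← integral_sub (integrable_ofReal_mul hv.pos_part q) (integrable_ofReal_mul hv.neg_part q),
      ← h q hq]
    simp only [← sub_mul, ← Complex.ofReal_sub, max_zero_sub_max_neg_zero_eq_self]
  have hfin : ∫⁻ x, ENNReal.ofReal (v x) ∂μ ≠ ⊤ := hv.lintegral_lt_top.ne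
  have hdensity := (withDensity_eq_iff hm.ennreal_ofReal hm.neg.ennreal_ofReal hfin).mp hmeasure
  filter_upwards [hdensity] with x hx
  have hparts : max (v x) 0 = max (-v x) 0 := by
    simpa only [ENNReal.toReal_ofReal', Pi.neg_apply] using congrArg ENNReal.toReal hx
  rw [← max_zero_sub_max_neg_zero_eq_self (v x), hparts, sub_self, Pi.zero_apply]

/-- `z` as a bounded continuous function, the generator of the trigonometric polynomials. -/
def boundedZ : ℝ →ᵇ ℂ :=
  BoundedContinuousFunction.ofNormedAddCommGroup z continuous_z 1 fun x => (norm_z x).le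

lemma boundedZ_apply (x : ℝ) : boundedZ x = z x := rfl

/-- The algebra of trigonometric polynomials on the circle, pulled back to the line along `z`. -/
def trigAlgebra : StarSubalgebra ℂ (ℝ →ᵇ ℂ) := StarAlgebra.adjoin ℂ {boundedZ}

lemma separatesPoints_trigAlgebra :
    (trigAlgebra.map (BoundedContinuousFunction.toContinuousMapStarₐ ℂ)).SeparatesPoints :=
  fun _ _ hxy => ⟨z, ⟨⟨z, continuous_z⟩,
    ⟨boundedZ, StarAlgebra.self_mem_adjoin_singleton ℂ _, rfl⟩, rfl⟩, z_injective.ne hxy⟩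

lemma mem_span_of_mem_trigAlgebra {q : ℝ →ᵇ ℂ} (hq : q ∈ trigAlgebra) :
    q ∈ Submodule.span ℂ {p : ℝ →ᵇ ℂ | ∃ n : ℤ, ∀ x, p x = z x ^ n} := by
  rw [trigAlgebra, ← StarSubalgebra.mem_toSubalgebra, StarAlgebra.adjoin_toSubalgebra,
    ← Subalgebra.mem_toSubmodule, Algebra.adjoin_eq_span] at hq
  refine Submodule.span_mono (fun p hp => ?_) hq
  induction hp using Submonoid.closure_induction with
  | mem p hp =>
    rcases hp with rfl | hp
    · exact ⟨1, fun x => by rw [boundedZ_apply, zpow_one]⟩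
    · obtain rfl : star boundedZ = p := (star_eq_iff_star_eq.mp hp)
      refine ⟨-1, fun x => ?_⟩
      rw [BoundedContinuousFunction.star_apply, boundedZ_apply, zpow_neg_one,
        Complex.inv_eq_conj (norm_z x), Complex.star_def]
  | one => exact ⟨0, fun x => by simp⟩
  | mul p q _ _ hp hq =>
    obtain ⟨⟨a, ha⟩, b, hb⟩ := And.intro hp hq
    exact ⟨a + b, fun x => by
      rw [BoundedContinuousFunction.mul_apply, ha, hb, zpow_add₀ (z_ne_zero x)]⟩

lemma integral_ofReal_mul_zpow_eq_zero {v : ℝ → ℝ} (hv : Integrable v)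
    (hf : ∀ k, ∫ x, v x * f k x = 0) (hg : ∀ k, ∫ x, v x * g k x = 0) (n : ℤ) :
    ∫ x, (v x : ℂ) * z x ^ n = 0 := by
  have hnat (k : ℕ) : ∫ x, (v x : ℂ) * z x ^ k = 0 := by
    have hint : Integrable fun x => (v x : ℂ) * z x ^ k :=
      integrable_ofReal_mul hv (boundedZ ^ k)
    have hcomp (ℓ : ℂ →L[ℝ] ℝ) : ℓ (∫ x, (v x : ℂ) * z x ^ k) = ∫ x, v x * mode ℓ k x := by
      rw [← ℓ.integral_comp_comm hint]
      simp only [map_ofReal_mul, mode]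
    exact Complex.ext ((hcomp Complex.reCLM).trans (hf k)) ((hcomp Complex.imCLM).trans (hg k))
  obtain ⟨k, rfl | rfl⟩ := n.eq_nat_or_neg
  · simpa only [zpow_natCast] using hnat k
  · have hconj := congrArg (starRingEnd ℂ) (hnat k)
    simpa only [← integral_conj, map_zero, map_mul, map_pow, Complex.conj_ofReal,
      ← Complex.inv_eq_conj (norm_z _), inv_pow, zpow_neg, zpow_natCast] using hconj

lemma integral_mul_eq_zero_of_mem_trigAlgebra {v : ℝ → ℝ} (hv : Integrable v)
    (h : ∀ n : ℤ, ∫ x, (v x : ℂ) * z x ^ n = 0) {q : ℝ →ᵇ ℂ} (hq : q ∈ trigAlgebra) :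
    ∫ x, (v x : ℂ) * q x = 0 := by
  replace hq := mem_span_of_mem_trigAlgebra hq
  induction hq using Submodule.span_induction with
  | mem p hp =>
    obtain ⟨n, hn⟩ := hp
    simp only [hn, h]
  | zero => simp
  | add p q _ _ hp hq =>
    simp only [BoundedContinuousFunction.add_apply, mul_add]
    rw [integral_add (integrable_ofReal_mul hv p) (integrable_ofReal_mul hv q), hp, hq, add_zero]
  | smul c p _ hp =>
    simp only [BoundedContinuousFunction.smul_apply, smul_eq_mul, mul_left_comm _ c]
    rw [integral_const_mul, hp, mul_zero]

lemma ae_eq_zero_of_integral_mul_f_g_eq_zero {v : ℝ → ℝ} (hv : Integrable v)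
    (hf : ∀ k, ∫ x, v x * f k x = 0) (hg : ∀ k, ∫ x, v x * g k x = 0) : v =ᵐ[volume] 0 :=
  ae_eq_zero_of_forall_mem_integral_mul_eq_zero hv separatesPoints_trigAlgebra fun _ hq =>
    integral_mul_eq_zero_of_mem_trigAlgebra hv (integral_ofReal_mul_zpow_eq_zero hv hf hg) hq

end Completeness

section Orthogonality

lemma integral_weight_mul_mode_mul_mode_of_ne (ℓ ℓ' : ℂ →L[ℝ] ℝ) {j k : ℕ} (h : j ≠ k) :
    ∫ x, weight x * mode ℓ j x * mode ℓ' k x = 0 := by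
  have hsymm := energy_comm (mode ℓ j) (mode ℓ' k)
  rw [energy_mode ℓ' k (memHdotHalf_mode ℓ j), energy_mode ℓ j (memHdotHalf_mode ℓ' k)] at hsymm
  simp only [mul_right_comm (weight _) (mode ℓ' k _)] at hsymm
  have hsub : (k - j : ℝ) * ∫ x, weight x * mode ℓ j x * mode ℓ' k x = 0 := by
    rw [sub_mul, hsymm, sub_self]
  exact (mul_eq_zero.mp hsub).resolve_left (sub_ne_zero.mpr (Nat.cast_injective.ne h.symm))

lemma f_sq_add_g_sq (k : ℕ) (x : ℝ) : f k x ^ 2 + g k x ^ 2 = 1 := by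
  have h := Complex.sq_norm_sub_sq_re (z x ^ k)
  rw [norm_pow, norm_z, one_pow, one_pow] at h
  simp only [f, g]
  linarith

lemma z_pow_two_mul (k : ℕ) (x : ℝ) : z x ^ (2 * k) = z x ^ k * z x ^ k := by
  rw [two_mul, pow_add]

lemma f_two_mul (k : ℕ) (x : ℝ) : f (2 * k) x = f k x ^ 2 - g k x ^ 2 := by
  simp only [f, g, z_pow_two_mul, Complex.mul_re, sq]

lemma g_two_mul (k : ℕ) (x : ℝ) : g (2 * k) x = 2 * (f k x * g k x) := by
  simp only [f, g, z_pow_two_mul, Complex.mul_im]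
  ring

lemma integral_weight_mul_f_mul_g (k : ℕ) : ∫ x, weight x * f k x * g k x = 0 := by
  rcases eq_or_ne k 0 with rfl | hk
  · simp [g]
  have hdouble := integral_weight_mul_mode Complex.imCLM (mul_ne_zero two_ne_zero hk)
  simp only [← g_eq_mode, g_two_mul, mul_left_comm _ (2 : ℝ), integral_const_mul,
    ← mul_assoc (weight _)] at hdouble
  exact (mul_eq_zero.mp hdouble).resolve_left two_ne_zero

lemma integral_weight_mul_f_sq {k : ℕ} (hk : k ≠ 0) : ∫ x, weight x * f k x ^ 2 = Real.pi := by
  have hf (x : ℝ) : weight x * f k x ^ 2 =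
      2⁻¹ * (weight x + weight x * mode Complex.reCLM (2 * k) x) := by
    rw [← f_eq_mode, f_two_mul]
    linear_combination weight x / 2 * f_sq_add_g_sq k x
  simp only [hf]
  rw [integral_const_mul,
    integral_add integrable_weight (integrable_mul_mode integrable_weight _ _),
    integral_weight_mul_mode _ (mul_ne_zero two_ne_zero hk), integral_weight, add_zero,
    inv_mul_cancel_left₀ two_ne_zero]

lemma integral_weight_mul_g_sq {k : ℕ} (hk : k ≠ 0) : ∫ x, weight x * g k x ^ 2 = Real.pi := by
  have hg (x : ℝ) : weight x * g k x ^ 2 =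
      2⁻¹ * (weight x - weight x * mode Complex.reCLM (2 * k) x) := by
    rw [← f_eq_mode, f_two_mul]
    linear_combination weight x / 2 * f_sq_add_g_sq k x
  simp only [hg]
  rw [integral_const_mul,
    integral_sub integrable_weight (integrable_mul_mode integrable_weight _ _),
    integral_weight_mul_mode _ (mul_ne_zero two_ne_zero hk), integral_weight, sub_zero,
    inv_mul_cancel_left₀ two_ne_zero]

/-- The functional picking the component of the trigonometric system of index `n : ℤ`: the real
part for `n ≥ 0` and the imaginary part for `n < 0`. -/
def part (n : ℤ) : ℂ →L[ℝ] ℝ := if 0 ≤ n then Complex.reCLM else Complex.imCLM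

/-- The real trigonometric system, indexed by `ℤ`: `f n` for `n ≥ 0` and `g |n|` for `n < 0`. -/
def trig (n : ℤ) : ℝ → ℝ := mode (part n) n.natAbs

lemma trig_of_nonneg {n : ℤ} (hn : 0 ≤ n) : trig n = f n.natAbs := by
  rw [trig, part, if_pos hn, f_eq_mode]

lemma trig_of_neg {n : ℤ} (hn : n < 0) : trig n = g n.natAbs := by
  rw [trig, part, if_neg hn.not_ge, g_eq_mode]

lemma integral_weight_mul_trig_mul_trig_of_ne {i j : ℤ} (h : i ≠ j) :
    ∫ x, weight x * trig i x * trig j x = 0 := by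
  by_cases hij : i.natAbs = j.natAbs
  · rcases lt_or_ge i 0 with hi | hi
    · rw [trig_of_neg hi, trig_of_nonneg (by lia), ← hij]
      simpa only [mul_right_comm (weight _)] using integral_weight_mul_f_mul_g i.natAbs
    · rw [trig_of_nonneg hi, trig_of_neg (by lia), ← hij, integral_weight_mul_f_mul_g]
  · exact integral_weight_mul_mode_mul_mode_of_ne _ _ hij

lemma integral_weight_mul_trig_sq_pos (n : ℤ) : 0 < ∫ x, weight x * trig n x ^ 2 := by
  rcases lt_trichotomy n 0 with hn | rfl | hn
  · rw [trig_of_neg hn, integral_weight_mul_g_sq (by lia)]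
    exact Real.pi_pos
  · simp only [trig_of_nonneg le_rfl, Int.natAbs_zero, f_eq_mode, mode_re_zero, one_pow, mul_one,
      integral_weight, Real.two_pi_pos]
  · rw [trig_of_nonneg hn.le, integral_weight_mul_f_sq (by lia)]
    exact Real.pi_pos

end Orthogonality


/-! ### Nullspaces and resonances -/

section DualFamily

variable {K ι V : Type*} [CommRing K] [AddCommGroup V] [Module K V] [DecidableEq ι] {v : ι → V}
  {c : ι → Module.Dual K V}

lemma eq_sum_of_dual_family (hdual : ∀ i j, c i (v j) = if i = j then 1 else 0)
    (hsep : ∀ x, (∀ i, c i x = 0) → x = 0) {S : Finset ι} {x : V} (hx : ∀ i ∉ S, c i x = 0) :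
    x = ∑ i ∈ S, c i x • v i := by
  rw [← sub_eq_zero]
  refine hsep _ fun i => ?_
  simp only [map_sub, map_sum, map_smul, hdual, smul_eq_mul, mul_ite, mul_one, mul_zero,
    Finset.sum_ite_eq]
  split_ifs with hi
  · rw [sub_self]
  · rw [hx i hi, sub_zero]

lemma eq_span_image_of_dual_family (hdual : ∀ i j, c i (v j) = if i = j then 1 else 0)
    (hsep : ∀ x, (∀ i, c i x = 0) → x = 0) (S : Finset ι) (N : Submodule K V)
    (hmem : ∀ i ∈ S, v i ∈ N) (hzero : ∀ x ∈ N, ∀ i ∉ S, c i x = 0) :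
    N = Submodule.span K (v '' S) := by
  refine le_antisymm (fun x hx => ?_) (Submodule.span_le.mpr (Set.image_subset_iff.mpr hmem))
  rw [eq_sum_of_dual_family hdual hsep (hzero x hx)]
  exact Submodule.sum_mem _ fun i hi =>
    Submodule.smul_mem _ _ (Submodule.subset_span (Set.mem_image_of_mem v hi))

lemma linearIndependent_of_dual_family (hdual : ∀ i j, c i (v j) = if i = j then 1 else 0) :
    LinearIndependent K v :=
  .of_pairwise_dual_eq_zero_one v c (fun i j hij => (hdual i j).trans (if_neg hij))
    fun i => (hdual i i).trans (if_pos rfl)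

end DualFamily

lemma finrank_span_image {K ι V : Type*} [Ring K] [StrongRankCondition K] [AddCommGroup V]
    [Module K V] {v : ι → V} (hv : LinearIndependent K v) (S : Finset ι) :
    Module.finrank K (Submodule.span K (v '' S)) = S.card := by
  classical
  have := nontrivial_of_invariantBasisNumber K
  have hS : LinearIndepOn K id (S.image v : Set V) :=
    hv.linearIndepOn_id.mono (by simp only [Finset.coe_image, Set.image_subset_range])
  rw [← Finset.coe_image, finrank_span_finset_eq_card hS,
    Finset.card_image_of_injective _ hv.injective]

section Basis

/-- The class of `ℓ (z ^ k)` as an element of `Ḣ^{1/2}(ℝ)`. -/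
def modeClass (ℓ : ℂ →L[ℝ] ℝ) (k : ℕ) : HdotHalf := ⟨_, (memHdotHalf_mode ℓ k).mk_mem⟩

lemma modeClass_ae_eq (ℓ : ℂ →L[ℝ] ℝ) (k : ℕ) :
    ((modeClass ℓ k : ℝ →ₘ[volume] ℝ) : ℝ → ℝ) =ᵐ[volume] mode ℓ k :=
  AEEqFun.coeFn_mk _ _

lemma coe_modeClass_re (k : ℕ) : (modeClass Complex.reCLM k : ℝ →ₘ[volume] ℝ) = fClass k := rfl

lemma coe_modeClass_im (k : ℕ) : (modeClass Complex.imCLM k : ℝ →ₘ[volume] ℝ) = gClass k := rfl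

/-- The class of `trig n` as an element of `Ḣ^{1/2}(ℝ)`. -/
def trigClass (n : ℤ) : HdotHalf := modeClass (part n) n.natAbs

lemma trigClass_of_nonneg {n : ℤ} (hn : 0 ≤ n) :
    (trigClass n : ℝ →ₘ[volume] ℝ) = fClass n.natAbs := by
  rw [trigClass, part, if_pos hn, coe_modeClass_re]

lemma trigClass_of_neg {n : ℤ} (hn : n < 0) :
    (trigClass n : ℝ →ₘ[volume] ℝ) = gClass n.natAbs := by
  rw [trigClass, part, if_neg hn.not_ge, coe_modeClass_im]

lemma integrable_weight_mul_mul_mode (φ : HdotHalf) (ℓ : ℂ →L[ℝ] ℝ) (k : ℕ) :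
    Integrable fun x => weight x * (φ : ℝ →ₘ[volume] ℝ) x * mode ℓ k x :=
  integrable_mul_mode (memHdotHalf_coe φ.2).memLHalf.integrable_weight_mul ℓ k

/-- The pairing `φ ↦ ∫ weight φ ℓ (z ^ k)` with a mode, on `Ḣ^{1/2}(ℝ)`. -/
def modePairing (ℓ : ℂ →L[ℝ] ℝ) (k : ℕ) : HdotHalf →ₗ[ℝ] ℝ where
  toFun φ := ∫ x, weight x * (φ : ℝ →ₘ[volume] ℝ) x * mode ℓ k x
  map_add' φ ψ := by
    rw [← integral_add (integrable_weight_mul_mul_mode φ ℓ k)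
      (integrable_weight_mul_mul_mode ψ ℓ k)]
    refine integral_congr_ae ?_
    filter_upwards [AEEqFun.coeFn_add (φ : ℝ →ₘ[volume] ℝ) ψ] with x hx
    rw [Submodule.coe_add, hx, Pi.add_apply, mul_add, add_mul]
  map_smul' c φ := by
    rw [RingHom.id_apply, smul_eq_mul, ← integral_const_mul]
    refine integral_congr_ae ?_
    filter_upwards [AEEqFun.coeFn_smul c (φ : ℝ →ₘ[volume] ℝ)] with x hx
    rw [Submodule.coe_smul, hx, Pi.smul_apply, smul_eq_mul, mul_left_comm, mul_assoc]

/-- The Fourier coefficients with respect to the trigonometric system, normalized so that they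
are dual to it. -/
def coeff (n : ℤ) : HdotHalf →ₗ[ℝ] ℝ :=
  (∫ x, weight x * trig n x ^ 2)⁻¹ • modePairing (part n) n.natAbs

lemma coeff_eq_zero_iff (n : ℤ) (φ : HdotHalf) :
    coeff n φ = 0 ↔ modePairing (part n) n.natAbs φ = 0 := by
  rw [coeff, LinearMap.smul_apply, smul_eq_mul,
    mul_eq_zero_iff_left (inv_ne_zero (integral_weight_mul_trig_sq_pos n).ne')]

lemma coeff_trigClass (i j : ℤ) : coeff i (trigClass j) = if i = j then 1 else 0 := by
  have hpair : modePairing (part i) i.natAbs (trigClass j) =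
      ∫ x, weight x * trig j x * trig i x := by
    refine integral_congr_ae ?_
    filter_upwards [modeClass_ae_eq (part j) j.natAbs] with x hx
    rw [trigClass, hx, trig, trig]
  split_ifs with h
  · subst h
    rw [coeff, LinearMap.smul_apply, hpair, smul_eq_mul]
    simp only [mul_assoc, ← sq]
    exact inv_mul_cancel₀ (integral_weight_mul_trig_sq_pos i).ne'
  · rw [coeff_eq_zero_iff, hpair, integral_weight_mul_trig_mul_trig_of_ne (Ne.symm h)]

lemma eq_zero_of_coeff_eq_zero {φ : HdotHalf} (h : ∀ n, coeff n φ = 0) : φ = 0 := by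
  have htrig (n : ℤ) : ∫ x, weight x * (φ : ℝ →ₘ[volume] ℝ) x * trig n x = 0 :=
    (coeff_eq_zero_iff n φ).mp (h n)
  have hae : (fun x => weight x * (φ : ℝ →ₘ[volume] ℝ) x) =ᵐ[volume] 0 := by
    refine ae_eq_zero_of_integral_mul_f_g_eq_zero
      (memHdotHalf_coe φ.2).memLHalf.integrable_weight_mul (fun k => ?_) fun k => ?_
    · simpa only [trig_of_nonneg (Int.natCast_nonneg k), Int.natAbs_natCast] using htrig k
    · rcases Nat.eq_zero_or_pos k with rfl | hk
      · simp [g]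
      · simpa only [trig_of_neg (neg_neg_of_pos (Int.natCast_pos.mpr hk)), Int.natAbs_neg,
          Int.natAbs_natCast] using htrig (-k)
  refine Subtype.ext (AEEqFun.ext (EventuallyEq.trans ?_ AEEqFun.coeFn_zero.symm))
  filter_upwards [hae] with x hx
  exact (mul_eq_zero.mp hx).resolve_left (weight_pos x).ne'

lemma eq_span_trigClass (S : Finset ℤ) {N : Submodule ℝ (ℝ →ₘ[volume] ℝ)} (hN : N ≤ HdotHalf)
    (hmem : ∀ n ∈ S, (trigClass n : ℝ →ₘ[volume] ℝ) ∈ N)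
    (hzero : ∀ φ : HdotHalf, (φ : ℝ →ₘ[volume] ℝ) ∈ N → ∀ n ∉ S,
      modePairing (part n) n.natAbs φ = 0) :
    N = Submodule.span ℝ ((fun n => (trigClass n : ℝ →ₘ[volume] ℝ)) '' S) := by
  have hcomap := eq_span_image_of_dual_family coeff_trigClass (fun _ => eq_zero_of_coeff_eq_zero)
    S (N.comap HdotHalf.subtype) hmem
    fun φ hφ n hn => (coeff_eq_zero_iff n φ).mpr (hzero φ hφ n hn)
  rw [← inf_eq_right.mpr hN, ← Submodule.map_comap_subtype, hcomap, Submodule.map_span,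
    Set.image_image]
  rfl

lemma finrank_span_trigClass (S : Finset ℤ) :
    Module.finrank ℝ (Submodule.span ℝ ((fun n => (trigClass n : ℝ →ₘ[volume] ℝ)) '' S)) =
      S.card :=
  finrank_span_image ((linearIndependent_of_dual_family coeff_trigClass).map' HdotHalf.subtype
    HdotHalf.ker_subtype) S

end Basis

section Nullspaces

lemma modeClass_mem_NLplus (ℓ : ℂ →L[ℝ] ℝ) (m : ℕ) :
    (modeClass ℓ m : ℝ →ₘ[volume] ℝ) ∈ NLplus m := by
  refine ⟨(modeClass ℓ m).2, fun ψ hψ hc => ?_⟩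
  rw [Lplus_congr m (modeClass_ae_eq ℓ m), Lplus_mode m ℓ m hψ hc, sub_self, zero_mul]

lemma modeClass_mem_NLminus (ℓ : ℂ →L[ℝ] ℝ) {m k : ℕ} (hk : k ≤ m) :
    (modeClass ℓ k : ℝ →ₘ[volume] ℝ) ∈ NLminus m := by
  refine ⟨(modeClass ℓ k).2, fun ψ hψ hc => ?_⟩
  rw [Lminus_congr m (modeClass_ae_eq ℓ k), Lminus_mode m ℓ k hψ hc, Nat.cast_sub hk]
  ring

lemma integral_weight_mul_eq_zero_of_mem_NLplus {m : ℕ} (hm : m ≠ 0) {φ : ℝ →ₘ[volume] ℝ}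
    (hφ : φ ∈ NLplus m) : ∫ x, weight x * φ x = 0 := by
  by_contra hmean
  have hfunctional (ℓ : ℂ →L[ℝ] ℝ) : ℓ (Complex.I ^ m) = 0 := by
    have h := sub_mul_integral_weight_mul_mode_of_Lplus m (memHdotHalf_coe hφ.1) hφ.2 ℓ m
    rw [sub_self, zero_mul, eq_comm, mul_eq_zero_iff_left (Nat.cast_ne_zero.mpr hm)] at h
    exact (mul_eq_zero.mp h).resolve_right hmean
  exact pow_ne_zero m Complex.I_ne_zero
    (Complex.ext (hfunctional Complex.reCLM) (hfunctional Complex.imCLM))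

lemma modePairing_eq_zero_of_mem_NLplus {m : ℕ} (hm : m ≠ 0) {φ : HdotHalf}
    (hφ : (φ : ℝ →ₘ[volume] ℝ) ∈ NLplus m) (ℓ : ℂ →L[ℝ] ℝ) {k : ℕ} (hk : k ≠ m) :
    modePairing ℓ k φ = 0 := by
  have h := sub_mul_integral_weight_mul_mode_of_Lplus m (memHdotHalf_coe hφ.1) hφ.2 ℓ k
  rw [integral_weight_mul_eq_zero_of_mem_NLplus hm hφ, mul_zero, mul_zero] at h
  exact (mul_eq_zero.mp h).resolve_left (sub_ne_zero.mpr (Nat.cast_injective.ne hk.symm))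

lemma modePairing_eq_zero_of_mem_NLminus {m : ℕ} {φ : HdotHalf}
    (hφ : (φ : ℝ →ₘ[volume] ℝ) ∈ NLminus m) (ℓ : ℂ →L[ℝ] ℝ) {k : ℕ} (hk : m < k) :
    modePairing ℓ k φ = 0 := by
  have h := sub_mul_integral_weight_mul_mode_of_Lminus m (memHdotHalf_coe hφ.1) hφ.2 ℓ k
  rw [Nat.sub_eq_zero_of_le hk.le, Nat.cast_zero, sub_zero] at h
  exact (mul_eq_zero.mp h).resolve_left (sub_ne_zero.mpr (Nat.cast_injective.ne hk.ne))

lemma NLplus_eq_span_trigClass {m : ℕ} (hm : m ≠ 0) :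
    NLplus m = Submodule.span ℝ
      ((fun n => (trigClass n : ℝ →ₘ[volume] ℝ)) '' ({(m : ℤ), -(m : ℤ)} : Finset ℤ)) := by
  have hindex (n : ℤ) : n ∈ ({(m : ℤ), -(m : ℤ)} : Finset ℤ) ↔ n.natAbs = m := by
    simp only [Finset.mem_insert, Finset.mem_singleton, Int.natAbs_eq_iff]
  refine eq_span_trigClass _ (fun φ hφ => hφ.1) (fun n hn => ?_) fun φ hφ n hn =>
    modePairing_eq_zero_of_mem_NLplus hm hφ _ (mt (hindex n).mpr hn)
  obtain rfl := (hindex n).mp hn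
  exact modeClass_mem_NLplus _ _

lemma NLminus_eq_span_trigClass (m : ℕ) :
    NLminus m = Submodule.span ℝ
      ((fun n => (trigClass n : ℝ →ₘ[volume] ℝ)) '' Finset.Icc (-(m : ℤ)) m) := by
  have hindex (n : ℤ) : n ∈ Finset.Icc (-(m : ℤ)) m ↔ n.natAbs ≤ m := by
    rw [Finset.mem_Icc]
    lia
  exact eq_span_trigClass _ (fun φ hφ => hφ.1)
    (fun n hn => modeClass_mem_NLminus _ ((hindex n).mp hn)) fun φ hφ n hn =>
    modePairing_eq_zero_of_mem_NLminus hφ _ (not_le.mp (mt (hindex n).mpr hn))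

lemma fClass_zero : fClass 0 = 1 :=
  congrArg (fun u : C(ℝ, ℝ) => AEEqFun.mk u u.continuous.aestronglyMeasurable)
    (show (⟨f 0, continuous_f 0⟩ : C(ℝ, ℝ)) = 1 by ext x; simp [f])

lemma image_trigClass_pair {m : ℕ} (hm : m ≠ 0) :
    (fun n => (trigClass n : ℝ →ₘ[volume] ℝ)) '' ({(m : ℤ), -(m : ℤ)} : Finset ℤ) =
      {fClass m, gClass m} := by
  rw [Finset.coe_pair, Set.image_pair, trigClass_of_nonneg (Int.natCast_nonneg m),
    trigClass_of_neg (by lia), Int.natAbs_neg, Int.natAbs_natCast]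

lemma image_trigClass_Icc (m : ℕ) :
    (fun n => (trigClass n : ℝ →ₘ[volume] ℝ)) '' Finset.Icc (-(m : ℤ)) m =
      {1} ∪ fClass '' Set.Icc 1 m ∪ gClass '' Set.Icc 1 m := by
  have hf (k : ℕ) : (trigClass k : ℝ →ₘ[volume] ℝ) = fClass k :=
    trigClass_of_nonneg (Int.natCast_nonneg k)
  have hg {k : ℕ} (hk : 1 ≤ k) : (trigClass (-(k : ℤ)) : ℝ →ₘ[volume] ℝ) = gClass k := by
    rw [trigClass_of_neg (by lia), Int.natAbs_neg, Int.natAbs_natCast]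
  rw [← fClass_zero]
  ext φ
  simp only [Finset.coe_Icc, Set.mem_image, Set.mem_union, Set.mem_singleton_iff, Set.mem_Icc]
  constructor
  · rintro ⟨n, ⟨hn, hn'⟩, rfl⟩
    rcases lt_trichotomy n 0 with h | rfl | h
    · exact .inr ⟨n.natAbs, by lia, (trigClass_of_neg h).symm⟩
    · exact .inl (.inl (hf 0))
    · exact .inl (.inr ⟨n.natAbs, by lia, (trigClass_of_nonneg h.le).symm⟩)
  · rintro ((rfl | ⟨k, hk, rfl⟩) | ⟨k, hk, rfl⟩)
    · exact ⟨0, by lia, hf 0⟩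
    · exact ⟨k, by lia, hf k⟩
    · exact ⟨-k, by lia, hg hk.1⟩

end Nullspaces

section Resonance

lemma not_memLp_of_tendsto {α E : Type*} [MeasurableSpace α] {μ : Measure α}
    [NormedAddCommGroup E] {l : Filter α} (hl : ∀ s ∈ l, μ s = ⊤) {u : α → E} {a : E}
    (h : Tendsto u l (𝓝 a)) (ha : a ≠ 0) {p : ENNReal} (hp : p ≠ 0) (hp' : p ≠ ⊤) :
    ¬ MemLp u p μ := by
  intro hu
  have hlarge : ∀ᶠ x in l, ‖a‖₊ / 2 ≤ ‖u x‖₊ :=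
    (h.nnnorm.eventually (lt_mem_nhds (half_lt_self (nnnorm_pos.mpr ha)))).mono fun _ => le_of_lt
  exact (hu.meas_ge_lt_top hp hp' (half_pos (nnnorm_pos.mpr ha)).ne').ne (hl _ hlarge)

lemma volume_eq_top_of_mem_atTop {s : Set ℝ} (hs : s ∈ atTop) : volume s = ⊤ := by
  obtain ⟨M, hM⟩ := mem_atTop_sets.mp hs
  exact measure_mono_top (fun x hx => hM x hx) (Real.volume_Ici (a := M))

lemma modeClass_notMem_Lp {ℓ : ℂ →L[ℝ] ℝ} {k : ℕ} (h : ℓ (Complex.I ^ k) ≠ 0) :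
    (modeClass ℓ k : ℝ →ₘ[volume] ℝ) ∉ Lp ℝ 2 (volume : Measure ℝ) := by
  rw [Lp.mem_Lp_iff_memLp, memLp_congr_ae (modeClass_ae_eq ℓ k)]
  exact not_memLp_of_tendsto (fun _ => volume_eq_top_of_mem_atTop)
    ((tendsto_mode_cocompact ℓ k).mono_left atTop_le_cocompact) h two_ne_zero ENNReal.ofNat_ne_top

lemma isResonance_modeClass {ℓ : ℂ →L[ℝ] ℝ} {m : ℕ} (h : ℓ (Complex.I ^ m) ≠ 0) :
    IsResonance (NLplus m) (modeClass ℓ m) ∧ IsResonance (NLminus m) (modeClass ℓ m) :=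
  ⟨⟨modeClass_mem_NLplus ℓ m, (modeClass ℓ m).2, modeClass_notMem_Lp h⟩,
    ⟨modeClass_mem_NLminus ℓ le_rfl, (modeClass ℓ m).2, modeClass_notMem_Lp h⟩⟩

lemma re_I_pow_ne_zero_of_even {m : ℕ} (hm : Even m) : (Complex.I ^ m).re ≠ 0 := by
  obtain ⟨j, rfl⟩ := hm
  rw [← two_mul, pow_mul, Complex.I_sq]
  rcases neg_one_pow_eq_or ℂ j with h | h <;> simp [h]

lemma im_I_pow_ne_zero_of_odd {m : ℕ} (hm : Odd m) : (Complex.I ^ m).im ≠ 0 := by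
  obtain ⟨j, rfl⟩ := hm
  rw [pow_succ, pow_mul, Complex.I_sq]
  rcases neg_one_pow_eq_or ℂ j with h | h <;> simp [h]

lemma exists_common_resonance (m : ℕ) : ∃ φ : ℝ →ₘ[volume] ℝ,
    IsResonance (NLplus m) φ ∧ IsResonance (NLminus m) φ ∧
      (Odd m → φ = gClass m) ∧ (Even m → φ = fClass m) := by
  rcases Nat.even_or_odd m with hm | hm
  · obtain ⟨hplus, hminus⟩ :=
      isResonance_modeClass (ℓ := Complex.reCLM) (re_I_pow_ne_zero_of_even hm)
    exact ⟨_, hplus, hminus, fun h => absurd hm (Nat.not_even_iff_odd.mpr h),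
      fun _ => coe_modeClass_re m⟩
  · obtain ⟨hplus, hminus⟩ :=
      isResonance_modeClass (ℓ := Complex.imCLM) (im_I_pow_ne_zero_of_odd hm)
    exact ⟨_, hplus, hminus, fun _ => coe_modeClass_im m,
      fun h => absurd hm (Nat.not_odd_iff_even.mpr h)⟩

end Resonance

end HalfHarmonic

end

theorem theorem3 (m : ℕ) (hm : 1 ≤ m) :
    HalfHarmonic.NLplus m = Submodule.span ℝ {HalfHarmonic.fClass m, HalfHarmonic.gClass m} ∧
    HalfHarmonic.NLminus m = Submodule.span ℝ
      ({1} ∪ HalfHarmonic.fClass '' Set.Icc 1 m ∪ HalfHarmonic.gClass '' Set.Icc 1 m) ∧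
    Module.finrank ℝ (HalfHarmonic.NLplus m) = 2 ∧
    Module.finrank ℝ (HalfHarmonic.NLminus m) = 2 * m + 1 ∧
    HalfHarmonic.Nondegenerate m ∧
    ∃ φ : ℝ →ₘ[MeasureTheory.volume] ℝ,
      HalfHarmonic.IsResonance (HalfHarmonic.NLplus m) φ ∧
      HalfHarmonic.IsResonance (HalfHarmonic.NLminus m) φ ∧
      (Odd m → φ = HalfHarmonic.gClass m) ∧
      (Even m → φ = HalfHarmonic.fClass m) := by
  have hm0 : m ≠ 0 := Nat.one_le_iff_ne_zero.mp hm
  have hplus := HalfHarmonic.NLplus_eq_span_trigClass hm0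
  have hminus := HalfHarmonic.NLminus_eq_span_trigClass m
  have hdimplus : Module.finrank ℝ (HalfHarmonic.NLplus m) = 2 := by
    rw [hplus, HalfHarmonic.finrank_span_trigClass]
    exact Finset.card_pair (by omega)
  have hdimminus : Module.finrank ℝ (HalfHarmonic.NLminus m) = 2 * m + 1 := by
    rw [hminus, HalfHarmonic.finrank_span_trigClass, Int.card_Icc]
    omega
  rw [HalfHarmonic.image_trigClass_pair hm0] at hplus
  rw [HalfHarmonic.image_trigClass_Icc] at hminus
  exact ⟨hplus, hminus, hdimplus, hdimminus, ⟨hdimplus, hdimminus⟩,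
    HalfHarmonic.exists_common_resonance m⟩
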